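/- A polynomial $f\in\mathbb{R}[x]$ is $\gamma$-positive if $f(x)=\sum_{i=0}^{\lfloor n/2\rfloor}\gamma_i x^i(1+x)^{n-2i}$ for some $n\in\mathbb{N}$ and some nonnegative reals $\gamma_0,\dots,\gamma_{\lfloor n/2\rfloor}$. The $h$-polynomial of a finite simplicial complex $\Delta$ of dimension $d-1$ is $h(\Delta,x)=\sum_{i=0}^{d} f_{i-1}(\Delta)\,x^i(1-x)^{d-i}$, where $f_{i-1}(\Delta)$ is the number of faces of $\Delta$ with $i$ vertices (so $f_{-1}(\Delta)=1$). A triangulation of a geometric simplicial complex $\Delta$ is a finite geometric simplicial complex $\Delta'$ with the same underlying space as $\Delta$, every simplex of which is contained in a simplex of $\Delta$; for a simplex $F$, $\Delta'_F$ denotes the subcomplex of all simplices of $\Delta'$ contained in $F$. If $\Gamma$ is a triangulation of the simplex with vertex set $W$, its local $h$-polynomial is $\ell_W(\Gamma,x)=\sum_{F\subseteq W}(-1)^{|W|-|F|}\,h(\Gamma_F,x)$. Let $V$ be a finite set, let $2^V$ be the simplex with vertex set $V$, realized as the standard simplex in $\mathbb{R}^V$, and let $\mathrm{sd}(2^V)$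 be its barycentric subdivision: its nonempty simplices are the convex hulls of the barycenters of the members of nonempty chains of nonempty faces of $2^V$. Let $\Gamma'$ be a triangulation of $\mathrm{sd}(2^V)$; it is also a triangulation of $2^V$. Corollary. If $\ell_E(\Gamma'_E,x)$ is $\gamma$-positive for every face $E$ of $\mathrm{sd}(2^V)$, then $\ell_V(\Gamma',x)$ is $\gamma$-positive. -/

import Mathlib

noncomputable section

namespace LocalH

open Polynomial Geometry

/-! ### Gamma-positivity -/

/-- A real polynomial `f` is `γ`-positive if
`f = ∑_{0 ≤ i ≤ ⌊n/2⌋} γ_i x^i (1+x)^(n-2i)` for some `n` and some nonnegative reals `γ_i`. -/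
def GammaPositive (f : ℝ[X]) : Prop :=
  ∃ (n : ℕ) (γ : ℕ → ℝ), (∀ i ∈ Finset.range (n / 2 + 1), 0 ≤ γ i) ∧
    f = ∑ i ∈ Finset.range (n / 2 + 1), C (γ i) * X ^ i * (1 + X) ^ (n - 2 * i)

/-! ### Geometric simplicial complexes, triangulations, restrictions

Mathlib's `Geometry.SimplicialComplex` lists the nonempty faces only; the empty face is
implicitly a face of every complex. -/

section Complexes

variable {E : Type*} [AddCommGroup E] [Module ℝ E]

/-- `f_{i-1}(K)`: the number of faces of `K` with `i` vertices, the empty face included. -/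
def faceNumber (K : SimplicialComplex ℝ E) (i : ℕ) : ℕ :=
  if i = 0 then 1 else {s | s ∈ K.faces ∧ s.card = i}.ncard

/-- The largest number of vertices of a face of a finite complex `K`, that is `dim K + 1`
(it is `0` if the empty face is the only face). -/
def dimSucc (K : SimplicialComplex ℝ E) : ℕ :=
  sSup (Finset.card '' K.faces)

/-- The `h`-polynomial `∑_{0 ≤ i ≤ d} f_{i-1}(K) x^i (1-x)^(d-i)`, where `d = dim K + 1`. -/
def hPoly (K : SimplicialComplex ℝ E) : ℝ[X] :=
  ∑ i ∈ Finset.range (dimSucc K + 1),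
    (faceNumber K i : ℝ[X]) * X ^ i * (1 - X) ^ (dimSucc K - i)

/-- `K'` is a (finite, geometric) triangulation of `K`: the two complexes have the same
underlying space and every simplex of `K'` is contained in some simplex of `K`. -/
structure IsTriangulation (K' K : SimplicialComplex ℝ E) : Prop where
  finite : K'.faces.Finite
  space_eq : K'.space = K.space
  exists_face : ∀ s ∈ K'.faces, ∃ t ∈ K.faces,
    convexHull ℝ (s : Set E) ⊆ convexHull ℝ (t : Set E)

/-- The restriction `K_F` of `K` to the geometric simplex with vertex set `F`:
all simplices of `K` contained in that simplex. -/
def restrict (K : SimplicialComplex ℝ E) (F : Finset E) : SimplicialComplex ℝ E where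
  faces := {s | s ∈ K.faces ∧ convexHull ℝ (s : Set E) ⊆ convexHull ℝ (F : Set E)}
  isRelLowerSet_faces := by
    rintro s ⟨hs, hsF⟩
    refine ⟨K.nonempty_of_mem_faces hs, fun t hts ht => ⟨K.down_closed hs hts ht, ?_⟩⟩
    exact (convexHull_mono (by exact_mod_cast hts)).trans hsF
  indep hs := K.indep hs.1
  inter_subset_convexHull hs ht := K.inter_subset_convexHull hs.1 ht.1

/-- The local `h`-polynomial `ℓ_W(K, x) = ∑_{F ⊆ W} (-1)^(|W|-|F|) h(K_F, x)` of a triangulation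
`K` of the geometric simplex with vertex set `W`. -/
def localH (K : SimplicialComplex ℝ E) (W : Finset E) : ℝ[X] :=
  ∑ F ∈ W.powerset, (-1) ^ (W.card - F.card) * hPoly (restrict K F)

end Complexes

/-! ### The simplex `2^V` and its barycentric subdivision

The simplex `2^V` is realized as the standard simplex in `V → ℝ`, whose vertices are the unit
coordinate vectors. -/

section Simplex

variable {V : Type*} [DecidableEq V]

/-- The vertices of the standard simplex in `V → ℝ`. -/
def simplexVertices (V : Type*) [Fintype V] [DecidableEq V] : Finset (V → ℝ) :=
  Finset.univ.image fun v : V => Pi.single v (1 : ℝ)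

/-- The barycenter of the face of the standard simplex spanned by `S`. -/
def barycenter (S : Finset V) : V → ℝ :=
  (S.card : ℝ)⁻¹ • ∑ v ∈ S, Pi.single v (1 : ℝ)

/-- Nonempty chains of nonempty subsets of `V`. -/
structure IsFaceChain (c : Finset (Finset V)) : Prop where
  nonempty : c.Nonempty
  empty_notMem : ∅ ∉ c
  isChain : IsChain (· ⊆ ·) (c : Set (Finset V))

lemma barycenter_apply (S : Finset V) (v : V) :
    barycenter S v = if v ∈ S then (S.card : ℝ)⁻¹ else 0 := by
  simp [barycenter, Finset.sum_apply, Pi.single_apply]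

lemma exists_mem_of_chain {c : Finset (Finset V)} (hc : IsFaceChain c) {S : Finset V}
    (hS : S ∈ c) : ∃ v ∈ S, ∀ T ∈ c, v ∈ T → S ⊆ T := by
  by_cases hne : (c.filter (· ⊂ S)).Nonempty
  · obtain ⟨T, hT, hmax⟩ := Finset.exists_max_image _ Finset.card hne
    rw [Finset.mem_filter] at hT
    obtain ⟨v, hvS, hvT⟩ := Finset.exists_of_ssubset hT.2
    refine ⟨v, hvS, fun U hU hvU => ?_⟩
    rcases hc.isChain.total hS hU with h | h
    · exact h
    · by_contra hn
      have h1 := hmax U (by rw [Finset.mem_filter]; exact ⟨hU, h, hn⟩)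
      rcases hc.isChain.total hT.1 hU with h2 | h2
      · exact hvT (Finset.eq_of_subset_of_card_le h2 h1 ▸ hvU)
      · exact hvT (h2 hvU)
  · obtain ⟨v, hv⟩ := Finset.nonempty_iff_ne_empty.2
      (fun h => hc.empty_notMem (h ▸ hS) : S ≠ ∅)
    refine ⟨v, hv, fun U hU _ => ?_⟩
    rcases hc.isChain.total hS hU with h | h
    · exact h
    · by_contra hn
      exact hne ⟨U, by rw [Finset.mem_filter]; exact ⟨hU, h, hn⟩⟩

lemma linearIndepOn_barycenter {c : Finset (Finset V)} (hc : IsFaceChain c) :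
    LinearIndepOn ℝ (barycenter (V := V)) (c : Set (Finset V)) := by
  rw [linearIndepOn_finset_iff]
  intro a ha
  by_contra! hcon
  obtain ⟨S₀, hS₀, hS₀a⟩ := hcon
  obtain ⟨S, hS, hmax⟩ := Finset.exists_max_image (c.filter fun T => a T ≠ 0) Finset.card
    ⟨S₀, by simp [hS₀, hS₀a]⟩
  rw [Finset.mem_filter] at hS
  obtain ⟨v, hv, hvT⟩ := exists_mem_of_chain hc hS.1
  have h := congrFun ha v
  rw [Finset.sum_apply, Finset.sum_eq_single S] at h
  · have hpos : (S.card : ℝ) ≠ 0 := by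
      exact_mod_cast (Finset.card_pos.2 ⟨v, hv⟩).ne'
    simp [barycenter_apply, hv, hS.2] at h
    exact (Finset.card_pos.2 ⟨v, hv⟩).ne' (by simp [h])
  · intro T hT hTS
    by_cases hvm : v ∈ T
    · have hST := hvT T hT hvm
      have : a T = 0 := by
        by_contra hne
        exact hTS (Finset.eq_of_subset_of_card_le hST
          (hmax T (by simp [hT, hne]))).symm
      simp [this]
    · simp [barycenter_apply, hvm]
  · exact fun h => absurd hS.1 h

lemma barycenter_injOn : Set.InjOn (barycenter (V := V)) {S | S ≠ ∅} := by
  have key : ∀ S T : Finset V, S ≠ ∅ → barycenter S = barycenter T → S ⊆ T := by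
    intro S T hS h v hv
    by_contra hn
    have h1 := congrFun h v
    simp [barycenter_apply, hv, hn] at h1
    exact hS h1
  intro S hS T hT h
  exact (key S T hS h).antisymm (key T S hT h.symm)

variable [Fintype V]

lemma affineIndependent_barycenter {c : Finset (Finset V)} (hc : IsFaceChain c) :
    AffineIndependent ℝ (fun y : ↥(c.image (barycenter (V := V))) => (y : V → ℝ)) := by
  have h := (linearIndepOn_barycenter hc).id_image.affineIndependent
  rw [← Finset.coe_image] at h
  exact h

/-- A point in the hull of the barycenters of a chain lies in the hull of the barycenters of a
subchain all of whose members are superlevel sets of the point. -/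
lemma exists_level_chain {c : Finset (Finset V)} (hc : IsFaceChain c) {x : V → ℝ}
    (hx : x ∈ convexHull ℝ ((c.image barycenter : Finset (V → ℝ)) : Set (V → ℝ))) :
    ∃ d ⊆ c, x ∈ convexHull ℝ ((d.image barycenter : Finset (V → ℝ)) : Set (V → ℝ)) ∧
      ∀ S ∈ d, ∃ r : ℝ, ∀ v, v ∈ S ↔ r ≤ x v := by
  have hinj : Set.InjOn (barycenter (V := V)) (c : Set (Finset V)) :=
    barycenter_injOn.mono fun S hS (h : S = ∅) => hc.empty_notMem (h ▸ hS)
  obtain ⟨w, hw0, hw1, hwx⟩ := Finset.mem_convexHull'.1 hx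
  rw [Finset.sum_image hinj] at hw1 hwx
  set a : Finset V → ℝ := fun S => w (barycenter S) with ha
  have ha0 : ∀ S ∈ c, 0 ≤ a S := fun S hS => hw0 _ (Finset.mem_image_of_mem _ hS)
  have hxv : ∀ v, x v = ∑ T ∈ c, if v ∈ T then a T * (T.card : ℝ)⁻¹ else 0 := by
    intro v
    rw [← hwx, Finset.sum_apply]
    refine Finset.sum_congr rfl fun T _ => ?_
    simp [barycenter_apply, ha]
  refine ⟨c.filter fun T => a T ≠ 0, Finset.filter_subset _ _, ?_, ?_⟩
  · rw [Finset.mem_convexHull']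
    refine ⟨w, ?_, ?_, ?_⟩
    · intro y hy
      exact hw0 y (Finset.image_subset_image (Finset.filter_subset _ _) hy)
    · rw [Finset.sum_image (hinj.mono (by exact_mod_cast Finset.filter_subset _ _)), Finset.sum_filter_of_ne, hw1]
      exact fun T _ h => h
    · rw [Finset.sum_image (hinj.mono (by exact_mod_cast Finset.filter_subset _ _)), Finset.sum_filter_of_ne, hwx]
      intro T _ h h0
      exact h (by simp only [ha] at h0; simp [h0])
  · intro S hS
    rw [Finset.mem_filter] at hS
    have hnn : ∀ T ∈ c, 0 ≤ a T * (T.card : ℝ)⁻¹ := fun T hT =>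
      mul_nonneg (ha0 T hT) (by positivity)
    refine ⟨∑ T ∈ c, if S ⊆ T then a T * (T.card : ℝ)⁻¹ else 0, fun v => ⟨?_, ?_⟩⟩
    · intro hv
      rw [hxv]
      refine Finset.sum_le_sum fun T hT => ?_
      by_cases h : S ⊆ T
      · simp [h, h hv]
      · simp only [h, if_false]
        split_ifs
        · exact hnn T hT
        · exact le_rfl
    · intro hle
      by_contra hv
      refine absurd hle (not_le.2 ?_)
      rw [hxv]
      refine Finset.sum_lt_sum (fun T hT => ?_) ⟨S, hS.1, ?_⟩
      · by_cases h : v ∈ T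
        · have hST : S ⊆ T := by
            rcases hc.isChain.total hS.1 hT with h' | h'
            · exact h'
            · exact absurd (h' h) hv
          simp [h, hST]
        · simp only [h, if_false]
          split_ifs
          · exact hnn T hT
          · exact le_rfl
      · have hSne : S.Nonempty := Finset.nonempty_iff_ne_empty.2
          fun h => hc.empty_notMem (h ▸ hS.1)
        simp only [hv, if_false, Finset.Subset.refl, if_true]
        exact mul_pos (lt_of_le_of_ne (ha0 S hS.1) (Ne.symm hS.2))
          (inv_pos.2 (by exact_mod_cast Finset.card_pos.2 hSne))

lemma barycenter_inter {c d : Finset (Finset V)} (hc : IsFaceChain c) (hd : IsFaceChain d) :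
    convexHull ℝ ((c.image barycenter : Finset (V → ℝ)) : Set (V → ℝ)) ∩
        convexHull ℝ ((d.image barycenter : Finset (V → ℝ)) : Set (V → ℝ)) ⊆
      convexHull ℝ (((c.image barycenter : Finset (V → ℝ)) : Set (V → ℝ)) ∩
        ((d.image barycenter : Finset (V → ℝ)) : Set (V → ℝ))) := by
  rintro x ⟨hxc, hxd⟩
  obtain ⟨c', hc', hxc', hcl⟩ := exists_level_chain hc hxc
  obtain ⟨d', hd', hxd', hdl⟩ := exists_level_chain hd hxd
  have hlev : ∀ S ∈ c' ∪ d', ∃ r : ℝ, ∀ v, v ∈ S ↔ r ≤ x v := by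
    intro S hS
    rcases Finset.mem_union.1 hS with h | h
    exacts [hcl S h, hdl S h]
  have hne : c'.Nonempty := by
    rw [Finset.nonempty_iff_ne_empty]
    rintro rfl
    simp at hxc'
  have hu : IsFaceChain (c' ∪ d') := by
    refine ⟨hne.mono Finset.subset_union_left, ?_, ?_⟩
    · intro h
      rcases Finset.mem_union.1 h with h | h
      exacts [hc.empty_notMem (hc' h), hd.empty_notMem (hd' h)]
    · intro S hS T hT _
      obtain ⟨r, hr⟩ := hlev S hS
      obtain ⟨q, hq⟩ := hlev T hT
      rcases le_total r q with h | h
      · exact Or.inr fun v hv => (hr v).2 (h.trans ((hq v).1 hv))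
      · exact Or.inl fun v hv => (hq v).2 (h.trans ((hr v).1 hv))
  have hinter := (affineIndependent_barycenter hu).convexHull_inter
    (t₁ := c'.image barycenter) (t₂ := d'.image barycenter)
    (Finset.image_subset_image Finset.subset_union_left)
    (Finset.image_subset_image Finset.subset_union_right)
  have hx : x ∈ convexHull ℝ (((c'.image barycenter : Finset (V → ℝ)) : Set (V → ℝ)) ∩
        ((d'.image barycenter : Finset (V → ℝ)) : Set (V → ℝ))) := by
    have hmem := Set.mem_inter hxc' hxd'
    rw [← hinter] at hmem
    simpa using hmem
  refine convexHull_mono (Set.inter_subset_inter ?_ ?_) hx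
  · exact_mod_cast Finset.image_subset_image hc'
  · exact_mod_cast Finset.image_subset_image hd'

/-- The barycentric subdivision `sd(2^V)` of the standard simplex: its (nonempty) faces are the
sets of barycenters of the members of nonempty chains of nonempty faces of the simplex. -/
def sdSimplex (V : Type*) [Fintype V] [DecidableEq V] : SimplicialComplex ℝ (V → ℝ) where
  faces := {s | ∃ c : Finset (Finset V), IsFaceChain c ∧ s = c.image barycenter}
  isRelLowerSet_faces := by
    rintro _ ⟨c, hc, rfl⟩
    refine ⟨hc.nonempty.image _, fun t ht htne => ?_⟩
    obtain ⟨d, hd, rfl⟩ := Finset.subset_image_iff.1 ht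
    refine ⟨d, ⟨Finset.image_nonempty.1 htne, fun h => hc.empty_notMem (hd h), ?_⟩, rfl⟩
    exact hc.isChain.mono (by exact_mod_cast hd)
  indep := by
    rintro _ ⟨c, hc, rfl⟩
    exact affineIndependent_barycenter hc
  inter_subset_convexHull := by
    rintro _ _ ⟨c, hc, rfl⟩ ⟨d, hd, rfl⟩
    exact barycenter_inter hc hd

end Simplex

end LocalH

end

noncomputable section

namespace LocalH

open Polynomial Geometry Filter Topology

/-! ### Gamma-positive polynomials with a prescribed centre of symmetry -/

/-! The local `h`-polynomial of `Γ'` over `2^V` decomposes along the faces `c` of `sd(2^V)`, the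
empty face included, as `∑ c, ℓ_c · r_c`. Here `ℓ_c` is the local `h`-polynomial of `Γ'` over `c`,
and `r_c` is the alternating sum, over the sets `S` containing all members of `c`, of the
`h`-polynomials of the links of `c` in `sd(2^S)` (`IsSdFan.sum_faceSum_single`). To see this, group
the simplices of `Γ'` by the face of `sd(2^V)` whose relative interior contains their own. Möbius
inversion then expresses each group through the polynomials `ℓ_c`.

The link of `c` in `sd(2^S)` is a join of subdivided boundaries of simplices with one further factor
that depends only on `|S| - |T|`, where `T` is the largest member of `c`. Its `h`-polynomial is
therefore a product of Eulerian polynomials, and the alternating sum over `S` turns the last factor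
into a derangement polynomial. Both families satisfy recurrences with nonnegative effect on the
basis `x^i (1+x)^j`, so `r_c` is `γ`-positive with centre `(|V| - |c|)/2`
(`sum_linkSum_mem_gammaCone`).

A sum of `γ`-positive polynomials need not be `γ`-positive unless the centres agree. Local
`h`-polynomials satisfy `x^|c| ℓ_c(1/x) = ℓ_c(x)` (`IsSdFan.localSum_symm`), which pins the centre
of `ℓ_c` to `|c|/2` (`GammaPositive.mem_gammaCone`); every product `ℓ_c · r_c` then has centre
`|V|/2`. The symmetry comes from the Dehn–Sommerville relations `IsFan.reversal`, obtained by
decomposing a fan into half-open cones along a generic direction `q` and comparing with `-q`. For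
this, simplices are replaced by the cones over them, all generators lying in the hyperplane where
the coordinates sum to one. -/

/-- The cone of polynomials that are `γ`-positive with centre of symmetry `n / 2`. -/
def gammaCone (n : ℕ) : AddSubmonoid ℝ[X] :=
  AddSubmonoid.closure
    {f | ∃ (c : ℝ) (i j : ℕ), 0 ≤ c ∧ 2 * i + j = n ∧ f = C c * X ^ i * (1 + X) ^ j}

lemma monomial_mem_gammaCone {n : ℕ} {c : ℝ} (i j : ℕ) (hc : 0 ≤ c) (h : 2 * i + j = n) :
    C c * X ^ i * (1 + X) ^ j ∈ gammaCone n :=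
  AddSubmonoid.subset_closure ⟨c, i, j, hc, h, rfl⟩

lemma one_mem_gammaCone : (1 : ℝ[X]) ∈ gammaCone 0 := by
  simpa using monomial_mem_gammaCone (n := 0) (c := 1) 0 0 zero_le_one rfl

lemma C_mul_mem_gammaCone {n : ℕ} {c : ℝ} (hc : 0 ≤ c) {f : ℝ[X]} (hf : f ∈ gammaCone n) :
    C c * f ∈ gammaCone n := by
  induction hf using AddSubmonoid.closure_induction with
  | mem f hf =>
    obtain ⟨b, i, j, hb, h, rfl⟩ := hf
    rw [← mul_assoc, ← mul_assoc, ← C_mul]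
    exact monomial_mem_gammaCone i j (mul_nonneg hc hb) h
  | zero => simp
  | add f g _ _ hf hg => rw [mul_add]; exact add_mem hf hg

lemma X_mul_mem_gammaCone {n : ℕ} {f : ℝ[X]} (hf : f ∈ gammaCone n) :
    X * f ∈ gammaCone (n + 2) := by
  induction hf using AddSubmonoid.closure_induction with
  | mem f hf =>
    obtain ⟨b, i, j, hb, h, rfl⟩ := hf
    have := monomial_mem_gammaCone (n := n + 2) (i + 1) j hb (by omega)
    rwa [show X * (C b * X ^ i * (1 + X) ^ j) = C b * X ^ (i + 1) * (1 + X) ^ j by ring]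
  | zero => simp
  | add f g _ _ hf hg => rw [mul_add]; exact add_mem hf hg

lemma mul_mem_gammaCone {m n : ℕ} {f g : ℝ[X]} (hf : f ∈ gammaCone m) (hg : g ∈ gammaCone n) :
    f * g ∈ gammaCone (m + n) := by
  induction hf using AddSubmonoid.closure_induction with
  | mem f hf =>
    obtain ⟨b, i, j, hb, h, rfl⟩ := hf
    induction hg using AddSubmonoid.closure_induction with
    | mem g hg =>
      obtain ⟨c, k, l, hc, h', rfl⟩ := hg
      have := monomial_mem_gammaCone (n := m + n) (i + k) (j + l) (mul_nonneg hb hc) (by omega)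
      rw [C_mul] at this
      convert this using 1
      ring
    | zero => simp
    | add f g _ _ hf hg => rw [mul_add]; exact add_mem hf hg
  | zero => simp
  | add f g _ _ hf hg => rw [add_mul]; exact add_mem hf hg

lemma gammaPositive_of_mem_gammaCone {n : ℕ} {f : ℝ[X]} (hf : f ∈ gammaCone n) :
    GammaPositive f := by
  suffices h : ∃ γ : ℕ → ℝ, (∀ i, 0 ≤ γ i) ∧
      f = ∑ i ∈ Finset.range (n / 2 + 1), C (γ i) * X ^ i * (1 + X) ^ (n - 2 * i) by
    obtain ⟨γ, h0, h⟩ := h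
    exact ⟨n, γ, fun i _ => h0 i, h⟩
  induction hf using AddSubmonoid.closure_induction with
  | mem f hf =>
    obtain ⟨b, i, j, hb, h, rfl⟩ := hf
    refine ⟨Pi.single i b, fun k => ?_, ?_⟩
    · rw [Pi.single_apply]; split_ifs <;> simp [hb]
    · rw [Finset.sum_eq_single i]
      · rw [Pi.single_eq_same, show n - 2 * i = j by omega]
      · intro k _ hk
        simp [hk]
      · intro hi
        exact absurd (Finset.mem_range.2 (by omega)) hi
  | zero => exact ⟨0, fun _ => le_rfl, by simp⟩
  | add f g _ _ hf hg =>
    obtain ⟨γ, h0, rfl⟩ := hf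
    obtain ⟨δ, h1, rfl⟩ := hg
    refine ⟨γ + δ, fun i => add_nonneg (h0 i) (h1 i), ?_⟩
    rw [← Finset.sum_add_distrib]
    refine Finset.sum_congr rfl fun i _ => ?_
    rw [Pi.add_apply, C_add]
    ring

/-- A `γ`-positive polynomial `f` with `x ^ n f(1/x) = f(x)` has centre of symmetry `n / 2`. -/
lemma GammaPositive.mem_gammaCone {n : ℕ} {f : ℝ[X]} (hf : GammaPositive f)
    (hsymm : ∀ x : ℝ, x ≠ 0 → x ^ n * f.eval x⁻¹ = f.eval x) : f ∈ gammaCone n := by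
  obtain ⟨m, γ, h0, hf⟩ := hf
  have hmem : f ∈ gammaCone m := by
    rw [hf]
    refine sum_mem fun i hi => monomial_mem_gammaCone i _ (h0 i hi) ?_
    have := Finset.mem_range.1 hi
    omega
  have hev : ∀ x : ℝ, f.eval x =
      ∑ i ∈ Finset.range (m / 2 + 1), γ i * x ^ i * (1 + x) ^ (m - 2 * i) := by
    intro x
    rw [hf, eval_finsetSum]
    simp
  -- One evaluation point suffices. At `2` the two symmetries give `2^m f(1/2) = 2^n f(1/2)`, and
  -- `f(1/2) ≠ 0` because all terms are nonnegative and `f ≠ 0`; hence `m = n`.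
  have hsymm' : (2 : ℝ) ^ m * f.eval 2⁻¹ = f.eval 2 := by
    rw [hev, hev, Finset.mul_sum]
    refine Finset.sum_congr rfl fun i hi => ?_
    have hi' := Finset.mem_range.1 hi
    obtain ⟨k, rfl⟩ : ∃ k, m = 2 * i + k := ⟨m - 2 * i, by omega⟩
    have h1 : (1 + 2 : ℝ) ^ k = 2 ^ k * (1 + 2⁻¹) ^ k := by rw [← mul_pow]; norm_num
    have h2 : (2 : ℝ) ^ i = 2 ^ (2 * i) * 2⁻¹ ^ i := by
      rw [two_mul, pow_add, mul_assoc, ← mul_pow]; norm_num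
    rw [Nat.add_sub_cancel_left, h1, h2, pow_add]
    ring
  rcases eq_or_ne f 0 with rfl | hne
  · exact zero_mem _
  have hpos : f.eval 2⁻¹ ≠ 0 := by
    intro h
    rw [hev, Finset.sum_eq_zero_iff_of_nonneg
      (fun i hi => by have := h0 i hi; positivity)] at h
    apply hne
    rw [hf]
    refine Finset.sum_eq_zero fun i hi => ?_
    have h1 := h i hi
    have : γ i = 0 := by
      by_contra hγ
      have : γ i * 2⁻¹ ^ i * (1 + 2⁻¹) ^ (m - 2 * i) ≠ 0 := by positivity
      exact this h1
    simp [this]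
  have h2 : (2 : ℝ) ^ m = 2 ^ n := mul_right_cancel₀ hpos (hsymm'.trans (hsymm 2 two_ne_zero).symm)
  have : m = n := by
    have h3 : (2 : ℕ) ^ m = 2 ^ n := by exact_mod_cast h2
    exact Nat.pow_right_injective le_rfl h3
  exact this ▸ hmem

/-! ### Eulerian and derangement polynomials -/

/-- The Eulerian polynomials `∑_{w ∈ S_n} x ^ des(w)`. -/
def eulerPoly : ℕ → ℝ[X]
  | 0 => 1
  | n + 1 => (1 + (n : ℝ[X]) * X) * eulerPoly n + X * (1 - X) * derivative (eulerPoly n)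

/-- For `2i + j = n` the operator sends `x^i (1+x)^j` to `(i+1) x^i (1+x)^(j+1) + 2j x^(i+1)
(1+x)^(j-1)`. -/
lemma eulerStep_mem_gammaCone {n : ℕ} {f : ℝ[X]} (hf : f ∈ gammaCone n) :
    (1 + ((n + 1 : ℕ) : ℝ[X]) * X) * f + X * (1 - X) * derivative f ∈ gammaCone (n + 1) := by
  induction hf using AddSubmonoid.closure_induction with
  | mem f hf =>
    obtain ⟨b, i, j, hb, rfl, rfl⟩ := hf
    have h1 := monomial_mem_gammaCone (n := 2 * i + j + 1) (c := b * (i + 1)) i (j + 1)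
      (by positivity) (by ring)
    rcases j with - | j
    · convert h1 using 1
      rcases i with - | i
      · simp; ring
      · simp; ring
    · have h2 := monomial_mem_gammaCone (n := 2 * i + (j + 1) + 1) (c := b * (2 * (j + 1))) (i + 1) j
        (by positivity) (by ring)
      convert add_mem h1 h2 using 1
      rcases i with - | i
      · simp [derivative_pow, map_ofNat]; ring
      · simp [derivative_pow, map_ofNat]; ring
  | zero => simp
  | add f g _ _ hf hg =>
    convert add_mem hf hg using 1
    rw [derivative_add]
    ring

/-- This is the Eulerian step minus `(1+x) f`, so the coefficient `i+1` there drops to `i`, still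
nonnegative. -/
lemma derangementStep_mem_gammaCone {n : ℕ} {f : ℝ[X]} (hf : f ∈ gammaCone n) :
    (n : ℝ[X]) * X * f + X * (1 - X) * derivative f ∈ gammaCone (n + 1) := by
  induction hf using AddSubmonoid.closure_induction with
  | mem f hf =>
    obtain ⟨b, i, j, hb, rfl, rfl⟩ := hf
    have h1 := monomial_mem_gammaCone (n := 2 * i + j + 1) (c := b * i) i (j + 1)
      (by positivity) (by ring)
    rcases j with - | j
    · convert h1 using 1
      rcases i with - | i
      · simp
      · simp; ring
    · have h2 := monomial_mem_gammaCone (n := 2 * i + (j + 1) + 1) (c := b * (2 * (j + 1))) (i + 1) j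
        (by positivity) (by ring)
      convert add_mem h1 h2 using 1
      rcases i with - | i
      · simp [derivative_pow, map_ofNat]; ring
      · simp [derivative_pow, map_ofNat]; ring
  | zero => simp
  | add f g _ _ hf hg =>
    convert add_mem hf hg using 1
    rw [derivative_add]
    ring

lemma eulerPoly_zero : eulerPoly 0 = 1 := rfl

lemma eulerPoly_succ (n : ℕ) : eulerPoly (n + 1) =
    (1 + (n : ℝ[X]) * X) * eulerPoly n + X * (1 - X) * derivative (eulerPoly n) := rfl

lemma eulerPoly_one : eulerPoly 1 = 1 := by simp [eulerPoly_succ, eulerPoly_zero]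

lemma eulerPoly_succ_mem_gammaCone (n : ℕ) : eulerPoly (n + 1) ∈ gammaCone n := by
  induction n with
  | zero => rw [eulerPoly_one]; exact one_mem_gammaCone
  | succ n ih => rw [eulerPoly_succ]; exact eulerStep_mem_gammaCone ih

/-! ### Binomial transforms of Eulerian polynomials and the derangement recurrence -/

/-- The binomial transform `∑ (n choose m) A_m c^(n-m)` of the Eulerian polynomials. -/
def eulerTransform (c : ℝ[X]) (n : ℕ) : ℝ[X] :=
  ∑ p ∈ Finset.HasAntidiagonal.antidiagonal n, (n.choose p.1 : ℝ[X]) * (eulerPoly p.1 * c ^ p.2)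

lemma eulerTransform_succ (c : ℝ[X]) (n : ℕ) : eulerTransform c (n + 1) =
    c * eulerTransform c n +
      ∑ p ∈ Finset.HasAntidiagonal.antidiagonal n, (n.choose p.1 : ℝ[X]) * (eulerPoly (p.1 + 1) * c ^ p.2) := by
  rw [eulerTransform, Finset.sum_antidiagonal_choose_succ_mul
    (fun i j => eulerPoly i * c ^ j), eulerTransform, Finset.mul_sum]
  congr 1
  · exact Finset.sum_congr rfl fun p _ => by ring
  · refine Finset.sum_congr rfl fun p hp => ?_
    rw [Nat.choose_symm_of_eq_add (Finset.HasAntidiagonal.mem_antidiagonal.1 hp).symm]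

/-- Applied to `(1-X)^j`, the operator `X(1-X) d/dX` gives `-jX(1-X)^j`. This turns the factor `1 +
(i+j)X` into the `1 + iX` of the Eulerian recurrence, so the recurrence passes through the
transform. -/
lemma eulerTransform_one_sub_X_succ (n : ℕ) : eulerTransform (1 - X) (n + 1) =
    (2 - X + (n : ℝ[X]) * X) * eulerTransform (1 - X) n +
      X * (1 - X) * derivative (eulerTransform (1 - X) n) := by
  rw [eulerTransform_succ]
  have : ∑ p ∈ Finset.HasAntidiagonal.antidiagonal n,
      (n.choose p.1 : ℝ[X]) * (eulerPoly (p.1 + 1) * (1 - X) ^ p.2) =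
      (1 + (n : ℝ[X]) * X) * eulerTransform (1 - X) n +
      X * (1 - X) * derivative (eulerTransform (1 - X) n) := by
    rw [eulerTransform, derivative_sum, Finset.mul_sum, Finset.mul_sum, ← Finset.sum_add_distrib]
    refine Finset.sum_congr rfl fun p hp => ?_
    rw [← Finset.HasAntidiagonal.mem_antidiagonal.1 hp, eulerPoly_succ]
    rcases p with ⟨i, j⟩
    rcases j with - | j
    · simp
    · simp [derivative_pow]; ring
  rw [this]
  ring

/-- Both sides obey the Eulerian recurrence. In `chainSum_empty` this identity is matched with the
sorting of chains by their largest member. -/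
lemma eulerPoly_eq_eulerTransform (n : ℕ) :
    eulerPoly n = (1 - X) ^ (n + 1) + X * eulerTransform (1 - X) n := by
  induction n with
  | zero => simp [eulerTransform, eulerPoly_zero]
  | succ n ih =>
    rw [eulerPoly_succ, ih, eulerTransform_one_sub_X_succ]
    simp [derivative_pow]
    ring

/-- The Eulerian recurrence under the sum asks for `iX` where `(n+1)X` is pulled out, `i + j = n+1`.
The defect `jX` is absorbed by `j · choose (n+1) i = (n+1) · choose n i`, which lowers the transform
by one index and gives the last term. -/
lemma eulerTransform_neg_one_add_two (n : ℕ) : eulerTransform (-1) (n + 2) =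
    ((n + 1 : ℕ) : ℝ[X]) * X * eulerTransform (-1) (n + 1) +
      X * (1 - X) * derivative (eulerTransform (-1) (n + 1)) +
      ((n + 1 : ℕ) : ℝ[X]) * X * eulerTransform (-1) n := by
  rw [eulerTransform_succ]
  have h1 : ∑ p ∈ Finset.HasAntidiagonal.antidiagonal (n + 1),
      ((n + 1).choose p.1 : ℝ[X]) * (eulerPoly (p.1 + 1) * (-1) ^ p.2) =
      (1 + ((n + 1 : ℕ) : ℝ[X]) * X) * eulerTransform (-1) (n + 1) +
      X * (1 - X) * derivative (eulerTransform (-1) (n + 1)) -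
      X * ∑ p ∈ Finset.HasAntidiagonal.antidiagonal (n + 1),
        ((n + 1).choose p.1 : ℝ[X]) * p.2 * (eulerPoly p.1 * (-1) ^ p.2) := by
    rw [eulerTransform, derivative_sum, Finset.mul_sum, Finset.mul_sum, Finset.mul_sum,
      ← Finset.sum_add_distrib, ← Finset.sum_sub_distrib]
    refine Finset.sum_congr rfl fun p hp => ?_
    rw [← Finset.HasAntidiagonal.mem_antidiagonal.1 hp, eulerPoly_succ]
    have : derivative ((-1 : ℝ[X]) ^ p.2) = 0 := by
      rw [derivative_pow]; simp
    simp [this]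
    ring
  have h2 : ∑ p ∈ Finset.HasAntidiagonal.antidiagonal (n + 1),
        ((n + 1).choose p.1 : ℝ[X]) * p.2 * (eulerPoly p.1 * (-1) ^ p.2) =
      - (((n + 1 : ℕ) : ℝ[X]) * eulerTransform (-1) n) := by
    rw [Finset.Nat.sum_antidiagonal_succ', eulerTransform, Finset.mul_sum, ← Finset.sum_neg_distrib]
    simp only [Nat.cast_zero, mul_zero, zero_mul, zero_add]
    refine Finset.sum_congr rfl fun p hp => ?_
    have hc : ((n + 1).choose p.1 : ℝ[X]) * ((p.2 + 1 : ℕ) : ℝ[X]) =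
        ((n + 1 : ℕ) : ℝ[X]) * (n.choose p.1 : ℝ[X]) := by
      rw [← Nat.cast_mul, ← Nat.cast_mul]
      have hp' := Finset.HasAntidiagonal.mem_antidiagonal.1 hp
      have := Nat.choose_mul_succ_eq n p.1
      rw [show n + 1 - p.1 = p.2 + 1 by omega] at this
      rw [← this, mul_comm]
    rw [hc, pow_succ]
    ring
  rw [h1, h2]
  ring

/-- The derangement polynomials are `γ`-positive. -/
lemma eulerTransform_neg_one_mem_gammaCone (n : ℕ) : eulerTransform (-1) n ∈ gammaCone n := by
  induction n using Nat.twoStepInduction with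
  | zero => simpa [eulerTransform, eulerPoly_zero] using one_mem_gammaCone
  | one =>
    have : eulerTransform (-1) 1 = 0 := by
      simp [eulerTransform, Finset.Nat.antidiagonal_succ, eulerPoly_zero, eulerPoly_one]
    rw [this]
    exact zero_mem _
  | more n ih0 ih1 =>
    rw [eulerTransform_neg_one_add_two]
    refine add_mem (derangementStep_mem_gammaCone ih1) ?_
    have := C_mul_mem_gammaCone (c := ((n + 1 : ℕ) : ℝ)) (by positivity) (X_mul_mem_gammaCone ih0)
    rw [map_natCast, ← mul_assoc] at this
    exact this

/-! ### Sums over chains of finite sets -/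

section Chains

variable {V : Type*}

lemma eq_of_mem_chain_of_card_eq {E : Finset (Finset V)}
    (hE : IsChain (· ⊆ ·) (E : Set (Finset V))) {S T : Finset V} (hS : S ∈ E) (hT : T ∈ E)
    (h : S.card = T.card) : S = T := by
  rcases hE.total hS hT with h' | h'
  · exact Finset.eq_of_subset_of_card_le h' h.ge
  · exact (Finset.eq_of_subset_of_card_le h' h.le).symm

lemma exists_top_of_chain {E : Finset (Finset V)}
    (hE : IsChain (· ⊆ ·) (E : Set (Finset V))) (hne : E.Nonempty) :
    ∃ T ∈ E, ∀ S ∈ E, S ⊆ T := by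
  obtain ⟨T, hT, hmax⟩ := Finset.exists_max_image E Finset.card hne
  refine ⟨T, hT, fun S hS => ?_⟩
  rcases hE.total hS hT with h | h
  · exact h
  · exact (Finset.eq_of_subset_of_card_le h (hmax S hS)).ge

lemma chain_trichotomy {E : Finset (Finset V)} (hE : IsChain (· ⊆ ·) (E : Set (Finset V)))
    {S T : Finset V} (hS : S ∈ E) (hT : T ∈ E) : S ⊂ T ∨ S = T ∨ T ⊂ S := by
  rcases eq_or_ne S T with h | h
  · exact Or.inr (Or.inl h)
  · rcases hE.total hS hT with h' | h'
    · exact Or.inl (h'.ssubset_of_ne h)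
    · exact Or.inr (Or.inr (h'.ssubset_of_ne h.symm))

/-- Members of a chain have distinct cardinalities. The bound ensures that the subtractions in the
exponents of `chainSum` do not truncate. -/
lemma card_chain_le {lo hi : Finset V} {E : Finset (Finset V)}
    (hE : IsChain (· ⊆ ·) (E : Set (Finset V))) (hlh : ∀ S ∈ E, lo ⊂ S ∧ S ⊂ hi) :
    E.card ≤ hi.card - lo.card - 1 := by
  have : E.card ≤ (Finset.Ioo lo.card hi.card).card :=
    Finset.card_le_card_of_injOn Finset.card
      (fun S hS => Finset.mem_coe.2 (Finset.mem_Ioo.2 ⟨Finset.card_lt_card (hlh S hS).1,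
        Finset.card_lt_card (hlh S hS).2⟩))
      (fun S hS T hT h => eq_of_mem_chain_of_card_eq hE hS hT h)
  simpa using this

variable [DecidableEq V]

open Classical in
/-- The chains of sets strictly between `lo` and `hi` that refine `G`. -/
def chainsBetween (lo hi : Finset V) (G : Finset (Finset V)) : Finset (Finset (Finset V)) :=
  (Finset.Ioo lo hi).powerset.filter
    fun E => IsChain (· ⊆ ·) (E : Set (Finset V)) ∧ G ⊆ E

lemma mem_chainsBetween {lo hi : Finset V} {G E : Finset (Finset V)} :
    E ∈ chainsBetween lo hi G ↔
      (∀ S ∈ E, lo ⊂ S ∧ S ⊂ hi) ∧ IsChain (· ⊆ ·) (E : Set (Finset V)) ∧ G ⊆ E := by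
  simp [chainsBetween, Finset.subset_iff]

/-- The weighted count of the chains strictly between `lo` and `hi` that refine `G`. -/
def chainSum (lo hi : Finset V) (G : Finset (Finset V)) : ℝ[X] :=
  ∑ E ∈ chainsBetween lo hi G,
    X ^ (E.card - G.card) * (1 - X) ^ (hi.card - lo.card - 1 - E.card)

lemma isChain_union {E F : Finset (Finset V)} (hE : IsChain (· ⊆ ·) (E : Set (Finset V)))
    (hF : IsChain (· ⊆ ·) (F : Set (Finset V))) (h : ∀ S ∈ E, ∀ T ∈ F, S ⊆ T) :
    IsChain (· ⊆ ·) ((E ∪ F : Finset (Finset V)) : Set (Finset V)) := by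
  intro S hS T hT hne
  rcases Finset.mem_union.1 hS with hS | hS <;> rcases Finset.mem_union.1 hT with hT | hT
  · exact hE hS hT hne
  · exact Or.inl (h S hS T hT)
  · exact Or.inr (h T hT S hS)
  · exact hF hS hT hne

lemma isChain_insert_top {E : Finset (Finset V)} {T : Finset V}
    (hE : IsChain (· ⊆ ·) (E : Set (Finset V))) (h : ∀ S ∈ E, S ⊆ T) :
    IsChain (· ⊆ ·) ((insert T E : Finset (Finset V)) : Set (Finset V)) := by
  rw [Finset.insert_eq, Finset.union_comm]
  exact isChain_union hE (by simp) (by simpa using h)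

lemma insert_filter_union_filter {E : Finset (Finset V)}
    (hE : IsChain (· ⊆ ·) (E : Set (Finset V))) {T : Finset V} (hT : T ∈ E) :
    insert T (E.filter (· ⊂ T) ∪ E.filter (T ⊂ ·)) = E := by
  ext S
  simp only [Finset.mem_insert, Finset.mem_union, Finset.mem_filter]
  constructor
  · rintro (rfl | h | h)
    exacts [hT, h.1, h.1]
  · intro hS
    rcases chain_trichotomy hE hS hT with h | h | h <;> simp [h, hS]

lemma card_insert_union {E F : Finset (Finset V)} {T : Finset V}
    (hE : ∀ S ∈ E, S ⊂ T) (hF : ∀ S ∈ F, T ⊂ S) :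
    (insert T (E ∪ F)).card = E.card + F.card + 1 := by
  rw [Finset.card_insert_of_notMem, Finset.card_union_of_disjoint]
  · rw [Finset.disjoint_left]
    exact fun S h1 h2 => ((hE S h1).trans (hF S h2)).ne rfl
  · intro h
    rcases Finset.mem_union.1 h with h | h
    exacts [(hE T h).ne rfl, (hF T h).ne rfl]

lemma card_filter_add_card_filter {E : Finset (Finset V)}
    (hE : IsChain (· ⊆ ·) (E : Set (Finset V))) {T : Finset V} (hT : T ∈ E) :
    E.card = (E.filter (· ⊂ T)).card + (E.filter (T ⊂ ·)).card + 1 := by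
  conv_lhs => rw [← insert_filter_union_filter hE hT]
  exact card_insert_union (fun S hS => (Finset.mem_filter.1 hS).2)
    (fun S hS => (Finset.mem_filter.1 hS).2)

lemma filter_ssubset_insert_union {E F : Finset (Finset V)} {T : Finset V}
    (hE : ∀ S ∈ E, S ⊂ T) (hF : ∀ S ∈ F, T ⊂ S) :
    (insert T (E ∪ F)).filter (· ⊂ T) = E := by
  ext S
  simp only [Finset.mem_insert, Finset.mem_union, Finset.mem_filter]
  constructor
  · rintro ⟨rfl | h | h, h'⟩
    exacts [absurd rfl h'.ne, h, absurd rfl ((hF S h).trans h').ne]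
  · exact fun h => ⟨Or.inr (Or.inl h), hE S h⟩

lemma filter_ssuperset_insert_union {E F : Finset (Finset V)} {T : Finset V}
    (hE : ∀ S ∈ E, S ⊂ T) (hF : ∀ S ∈ F, T ⊂ S) :
    (insert T (E ∪ F)).filter (T ⊂ ·) = F := by
  ext S
  simp only [Finset.mem_insert, Finset.mem_union, Finset.mem_filter]
  constructor
  · rintro ⟨rfl | h | h, h'⟩
    exacts [absurd rfl h'.ne, absurd rfl ((hE S h).trans h').ne, h]
  · exact fun h => ⟨Or.inr (Or.inr h), hF S h⟩

/-- A chain through `T` is a pair of independent chains, one below and one above `T`. Passing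
through `T` costs one unit of rank, exactly what the member `T` itself contributes to the
cardinality. -/
lemma chainSum_split {lo hi T : Finset V} {G : Finset (Finset V)}
    (hG : IsChain (· ⊆ ·) (G : Set (Finset V))) (hT : T ∈ G) (hlo : lo ⊂ T) (hhi : T ⊂ hi) :
    chainSum lo hi G = chainSum lo T (G.filter (· ⊂ T)) * chainSum T hi (G.filter (T ⊂ ·)) := by
  rw [chainSum, chainSum, chainSum, Finset.sum_mul_sum, ← Finset.sum_product']
  refine Finset.sum_bij' (fun E _ => (E.filter (· ⊂ T), E.filter (T ⊂ ·)))
    (fun p _ => insert T (p.1 ∪ p.2)) ?_ ?_ ?_ ?_ ?_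
  · intro E hE
    obtain ⟨h1, h2, h3⟩ := mem_chainsBetween.1 hE
    refine Finset.mem_product.2 ⟨mem_chainsBetween.2 ⟨?_, ?_, ?_⟩,
      mem_chainsBetween.2 ⟨?_, ?_, ?_⟩⟩
    · intro S hS
      exact ⟨(h1 S (Finset.mem_filter.1 hS).1).1, (Finset.mem_filter.1 hS).2⟩
    · exact h2.mono (by exact_mod_cast Finset.filter_subset _ _)
    · exact Finset.filter_subset_filter _ h3
    · intro S hS
      exact ⟨(Finset.mem_filter.1 hS).2, (h1 S (Finset.mem_filter.1 hS).1).2⟩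
    · exact h2.mono (by exact_mod_cast Finset.filter_subset _ _)
    · exact Finset.filter_subset_filter _ h3
  · rintro ⟨E, F⟩ hp
    obtain ⟨hE, hF⟩ := Finset.mem_product.1 hp
    obtain ⟨h1, h2, h3⟩ := mem_chainsBetween.1 hE
    obtain ⟨k1, k2, k3⟩ := mem_chainsBetween.1 hF
    refine mem_chainsBetween.2 ⟨?_, ?_, ?_⟩
    · intro S hS
      simp only [Finset.mem_insert, Finset.mem_union] at hS
      rcases hS with rfl | hS | hS
      · exact ⟨hlo, hhi⟩
      · exact ⟨(h1 S hS).1, (h1 S hS).2.trans hhi⟩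
      · exact ⟨hlo.trans (k1 S hS).1, (k1 S hS).2⟩
    · rw [← Finset.insert_union]
      refine isChain_union (isChain_insert_top h2 fun S hS => (h1 S hS).2.subset) k2 ?_
      intro S hS U hU
      rcases Finset.mem_insert.1 hS with rfl | hS
      · exact (k1 U hU).1.subset
      · exact (h1 S hS).2.subset.trans (k1 U hU).1.subset
    · rw [← insert_filter_union_filter hG hT]
      exact Finset.insert_subset_insert _ (Finset.union_subset_union h3 k3)
  · intro E hE
    obtain ⟨h1, h2, h3⟩ := mem_chainsBetween.1 hE
    exact insert_filter_union_filter h2 (h3 hT)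
  · rintro ⟨E, F⟩ hp
    obtain ⟨hE, hF⟩ := Finset.mem_product.1 hp
    have h1 := fun S hS => ((mem_chainsBetween.1 hE).1 S hS).2
    have k1 := fun S hS => ((mem_chainsBetween.1 hF).1 S hS).1
    exact Prod.ext (filter_ssubset_insert_union h1 k1) (filter_ssuperset_insert_union h1 k1)
  · intro E hE
    obtain ⟨h1, h2, h3⟩ := mem_chainsBetween.1 hE
    have e1 := card_filter_add_card_filter hG hT
    have e2 := card_filter_add_card_filter h2 (h3 hT)
    have b1 := card_chain_le (E := E.filter (· ⊂ T)) (lo := lo) (hi := T)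
      (h2.mono (by exact_mod_cast Finset.filter_subset (· ⊂ T) E))
      (fun S hS => ⟨(h1 S (Finset.mem_filter.1 hS).1).1, (Finset.mem_filter.1 hS).2⟩)
    have b2 := card_chain_le (E := E.filter (T ⊂ ·)) (lo := T) (hi := hi)
      (h2.mono (by exact_mod_cast Finset.filter_subset (T ⊂ ·) E))
      (fun S hS => ⟨(Finset.mem_filter.1 hS).2, (h1 S (Finset.mem_filter.1 hS).1).2⟩)
    have c1 := Finset.card_le_card (Finset.filter_subset_filter (· ⊂ T) h3)
    have c2 := Finset.card_le_card (Finset.filter_subset_filter (T ⊂ ·) h3)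
    have d1 := Finset.card_lt_card hlo
    have d2 := Finset.card_lt_card hhi
    simp only
    rw [mul_mul_mul_comm, ← pow_add, ← pow_add]
    congr 2 <;> omega

/-! ### Sums over intervals of finite sets and the Eulerian formula for chain sums -/

lemma sum_Icc_eq_sum_powerset {α M : Type*} [DecidableEq α] [AddCommMonoid M] {lo hi : Finset α}
    (h : lo ⊆ hi) (f : ℕ → ℕ → M) :
    ∑ S ∈ Finset.Icc lo hi, f (S.card - lo.card) (hi.card - S.card) =
      ∑ U ∈ (hi \ lo).powerset, f U.card ((hi \ lo).card - U.card) := by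
  have hd : ∀ U ∈ (hi \ lo).powerset, Disjoint lo U := fun U hU =>
    Finset.disjoint_of_subset_right (Finset.mem_powerset.1 hU) Finset.disjoint_sdiff
  rw [Finset.Icc_eq_image_powerset h, Finset.sum_image]
  · refine Finset.sum_congr rfl fun U hU => ?_
    rw [Finset.card_union_of_disjoint (hd U hU), Finset.card_sdiff_of_subset h,
      Nat.add_sub_cancel_left, Nat.sub_sub]
  · intro U hU W hW hUW
    rw [← Finset.union_sdiff_cancel_left (hd U hU), ← Finset.union_sdiff_cancel_left (hd W hW)]
    exact congrArg (· \ lo) hUW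

lemma sum_Icc_pow_mul_pow {α R : Type*} [DecidableEq α] [CommSemiring R] (c d : R)
    {lo hi : Finset α} (h : lo ⊆ hi) :
    ∑ S ∈ Finset.Icc lo hi, c ^ (S.card - lo.card) * d ^ (hi.card - S.card) =
      (c + d) ^ (hi.card - lo.card) := by
  rw [sum_Icc_eq_sum_powerset h fun m n => c ^ m * d ^ n, Finset.sum_pow_mul_eq_add_pow,
    Finset.card_sdiff_of_subset h]

lemma sum_Icc_eulerPoly (c : ℝ[X]) {lo hi : Finset V} (h : lo ⊆ hi) :
    ∑ S ∈ Finset.Icc lo hi, eulerPoly (S.card - lo.card) * c ^ (hi.card - S.card) =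
      eulerTransform c (hi.card - lo.card) := by
  rw [sum_Icc_eq_sum_powerset h fun m n => eulerPoly m * c ^ n, Finset.sum_powerset_apply_card
    (fun m => eulerPoly m * c ^ ((hi \ lo).card - m)), eulerTransform,
    Finset.Nat.sum_antidiagonal_eq_sum_range_succ_mk, Finset.card_sdiff_of_subset h]
  simp

/-- Nonempty chains are sorted by their largest member `S`, which supplies the factor `X`; what
remains is a chain strictly below `S`. The first term is the empty chain. -/
lemma chainSum_empty_rec {lo hi : Finset V} :
    chainSum lo hi ∅ = (1 - X) ^ (hi.card - lo.card - 1) +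
      ∑ S ∈ Finset.Ioo lo hi, X * (1 - X) ^ (hi.card - S.card - 1) * chainSum lo S ∅ := by
  have hmem : ∅ ∈ chainsBetween lo hi ∅ := by simp [mem_chainsBetween]
  rw [chainSum, ← Finset.add_sum_erase _ _ hmem]
  congr 1
  · simp
  have hsup : ∀ {E : Finset (Finset V)} {T : Finset V}, T ∈ E → (∀ S ∈ E, S ⊆ T) →
      E.sup id = T := fun hT h =>
    le_antisymm (Finset.sup_le h) (Finset.le_sup (f := id) hT)
  rw [← Finset.sum_fiberwise_of_maps_to (s := (chainsBetween lo hi ∅).erase ∅)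
    (t := Finset.Ioo lo hi) (g := fun E => E.sup id)]
  · refine Finset.sum_congr rfl fun S hS => ?_
    rw [Finset.mem_Ioo] at hS
    rw [chainSum, Finset.mul_sum]
    have hfib : ∀ E ∈ ((chainsBetween lo hi ∅).erase ∅).filter (fun E => E.sup id = S),
        S ∈ E ∧ ∀ U ∈ E, U ⊆ S := by
      intro E hE
      obtain ⟨hE, hES⟩ := Finset.mem_filter.1 hE
      obtain ⟨hne, hE⟩ := Finset.mem_erase.1 hE
      obtain ⟨h1, h2, -⟩ := mem_chainsBetween.1 hE
      obtain ⟨T, hT, hmax⟩ := exists_top_of_chain h2 (Finset.nonempty_iff_ne_empty.2 hne)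
      have := (hsup hT hmax).symm.trans hES
      subst this
      exact ⟨hT, hmax⟩
    refine Finset.sum_bij' (fun E _ => E.erase S) (fun E _ => insert S E) ?_ ?_ ?_ ?_ ?_
    · intro E hE
      obtain ⟨hSE, hmax⟩ := hfib E hE
      obtain ⟨h1, h2, -⟩ :=
        mem_chainsBetween.1 (Finset.mem_erase.1 (Finset.mem_filter.1 hE).1).2
      refine mem_chainsBetween.2 ⟨?_, ?_, by simp⟩
      · intro U hU
        obtain ⟨hne, hU⟩ := Finset.mem_erase.1 hU
        exact ⟨(h1 U hU).1, (hmax U hU).ssubset_of_ne hne⟩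
      · exact h2.mono (by exact_mod_cast Finset.erase_subset _ _)
    · intro E hE
      obtain ⟨h1, h2, -⟩ := mem_chainsBetween.1 hE
      refine Finset.mem_filter.2 ⟨Finset.mem_erase.2 ⟨Finset.insert_ne_empty _ _,
        mem_chainsBetween.2 ⟨?_, isChain_insert_top h2 fun U hU => (h1 U hU).2.subset,
          by simp⟩⟩, hsup (Finset.mem_insert_self _ _) ?_⟩
      · intro U hU
        rcases Finset.mem_insert.1 hU with rfl | hU
        · exact hS
        · exact ⟨(h1 U hU).1, (h1 U hU).2.trans hS.2⟩
      · intro U hU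
        rcases Finset.mem_insert.1 hU with rfl | hU
        · exact subset_rfl
        · exact (h1 U hU).2.subset
    · intro E hE
      exact Finset.insert_erase (hfib E hE).1
    · intro E hE
      exact Finset.erase_insert fun h => ((mem_chainsBetween.1 hE).1 S h).2.ne rfl
    · intro E hE
      obtain ⟨hSE, hmax⟩ := hfib E hE
      obtain ⟨h1, h2, -⟩ :=
        mem_chainsBetween.1 (Finset.mem_erase.1 (Finset.mem_filter.1 hE).1).2
      have b := card_chain_le (E := E.erase S) (lo := lo) (hi := S)
        (h2.mono (by exact_mod_cast Finset.erase_subset _ _)) (fun U hU => by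
          obtain ⟨hne, hU⟩ := Finset.mem_erase.1 hU
          exact ⟨(h1 U hU).1, (hmax U hU).ssubset_of_ne hne⟩)
      have hc := Finset.card_erase_add_one hSE
      have d1 := Finset.card_lt_card hS.1
      have d2 := Finset.card_lt_card hS.2
      rw [mul_mul_mul_comm, ← pow_succ', ← pow_add]
      congr 2
      · simp only [Finset.card_empty]; omega
      · omega
  · intro E hE
    obtain ⟨hne, hE⟩ := Finset.mem_erase.1 hE
    obtain ⟨h1, h2, -⟩ := mem_chainsBetween.1 hE
    obtain ⟨T, hT, hmax⟩ := exists_top_of_chain h2 (Finset.nonempty_iff_ne_empty.2 hne)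
    rw [hsup hT hmax]
    exact Finset.mem_Ioo.2 (h1 T hT)

lemma one_sub_X_ne_zero : (1 - X : ℝ[X]) ≠ 0 := by
  intro h
  simpa using congrArg (eval 0) h

/-- The `h`-polynomial of the barycentric subdivision of the boundary of a simplex is an
Eulerian polynomial. -/
lemma chainSum_empty (lo : Finset V) : ∀ {hi : Finset V}, lo ⊂ hi →
    chainSum lo hi ∅ = eulerPoly (hi.card - lo.card) := by
  intro hi
  induction hi using Finset.strongInduction with
  | H hi ih =>
    intro h
    -- The exponents of `1 - X` in `chainSum_empty_rec` are one short of those in `eulerTransform (1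
    -- - X)`; multiplying by `1 - X` aligns them.
    refine mul_left_cancel₀ one_sub_X_ne_zero ?_
    have hlt := Finset.card_lt_card h
    have hIcc : Finset.Icc lo hi = insert lo (insert hi (Finset.Ioo lo hi)) := by
      rw [Finset.insert_comm, Finset.Ioo_insert_left h]
      exact (Finset.Ico_insert_right h.subset).symm
    have hsum := sum_Icc_eulerPoly (1 - X) h.subset
    rw [hIcc, Finset.sum_insert (by simp [h.ne]), Finset.sum_insert (by simp),
      Nat.sub_self, Nat.sub_self, eulerPoly_zero, pow_zero] at hsum
    have hrec : (1 - X) * chainSum lo hi ∅ = (1 - X) ^ (hi.card - lo.card) +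
        X * ∑ S ∈ Finset.Ioo lo hi,
          eulerPoly (S.card - lo.card) * (1 - X) ^ (hi.card - S.card) := by
      rw [chainSum_empty_rec, mul_add, ← pow_succ', Finset.mul_sum, Finset.mul_sum]
      rw [Nat.sub_add_cancel (by omega : 1 ≤ hi.card - lo.card)]
      refine congrArg₂ (· + ·) rfl (Finset.sum_congr rfl fun S hS => ?_)
      obtain ⟨h1, h2⟩ := Finset.mem_Ioo.1 hS
      have d2 := Finset.card_lt_card h2
      have hpow : (1 - X : ℝ[X]) ^ (hi.card - S.card) =
          (1 - X) * (1 - X) ^ (hi.card - S.card - 1) := by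
        rw [← pow_succ', Nat.sub_add_cancel (by omega)]
      rw [ih S h2 h1, hpow]
      ring
    have heq := eulerPoly_eq_eulerTransform (hi.card - lo.card)
    rw [← hsum, pow_succ] at heq
    rw [hrec]
    linear_combination -heq

/-- Splitting at the members of `G` leaves a product of Eulerian polynomials, one for each gap of
the chain from `lo` to `hi`. A gap of size `k` contributes `k - 1` to the index, so the `|G| + 1`
gaps contribute `|hi| - |lo| - 1 - |G|` in all. -/
lemma chainSum_mem_gammaCone {lo hi : Finset V} (h : lo ⊂ hi) {G : Finset (Finset V)}
    (hG : IsChain (· ⊆ ·) (G : Set (Finset V))) (hlh : ∀ S ∈ G, lo ⊂ S ∧ S ⊂ hi) :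
    chainSum lo hi G ∈ gammaCone (hi.card - lo.card - 1 - G.card) := by
  induction G using Finset.strongInduction generalizing lo hi with
  | H G ih =>
    rcases G.eq_empty_or_nonempty with rfl | ⟨T, hT⟩
    · have hlt := Finset.card_lt_card h
      rw [chainSum_empty lo h, Finset.card_empty,
        show hi.card - lo.card = hi.card - lo.card - 1 - 0 + 1 by omega]
      exact eulerPoly_succ_mem_gammaCone _
    · obtain ⟨h1, h2⟩ := hlh T hT
      have l1 : ∀ S ∈ G.filter (· ⊂ T), lo ⊂ S ∧ S ⊂ T := fun S hS =>
        ⟨(hlh S (Finset.mem_filter.1 hS).1).1, (Finset.mem_filter.1 hS).2⟩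
      have l2 : ∀ S ∈ G.filter (T ⊂ ·), T ⊂ S ∧ S ⊂ hi := fun S hS =>
        ⟨(Finset.mem_filter.1 hS).2, (hlh S (Finset.mem_filter.1 hS).1).2⟩
      have c1 : IsChain (· ⊆ ·) ((G.filter (· ⊂ T) : Finset (Finset V)) : Set (Finset V)) :=
        hG.mono (Finset.coe_subset.2 (Finset.filter_subset _ _))
      have c2 : IsChain (· ⊆ ·) ((G.filter (T ⊂ ·) : Finset (Finset V)) : Set (Finset V)) :=
        hG.mono (Finset.coe_subset.2 (Finset.filter_subset _ _))
      have m1 := ih _ (Finset.filter_ssubset.2 ⟨T, hT, fun h => h.ne rfl⟩) h1 c1 l1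
      have m2 := ih _ (Finset.filter_ssubset.2 ⟨T, hT, fun h => h.ne rfl⟩) h2 c2 l2
      have b1 := card_chain_le c1 l1
      have b2 := card_chain_le c2 l2
      have hc := card_filter_add_card_filter hG hT
      have d1 := Finset.card_lt_card h1
      have d2 := Finset.card_lt_card h2
      rw [chainSum_split hG hT h1 h2]
      convert mul_mem_gammaCone m1 m2 using 2
      omega

/-! ### Links in the barycentric subdivision of a full simplex -/

open Classical in
/-- The chains of nonempty subsets of `S` that refine `G`. -/
def faceChains (S : Finset V) (G : Finset (Finset V)) : Finset (Finset (Finset V)) :=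
  (Finset.Ioc ∅ S).powerset.filter
    fun E => IsChain (· ⊆ ·) (E : Set (Finset V)) ∧ G ⊆ E

lemma mem_faceChains {S : Finset V} {G E : Finset (Finset V)} :
    E ∈ faceChains S G ↔ (∀ U ∈ E, U ≠ ∅ ∧ U ⊆ S) ∧
      IsChain (· ⊆ ·) (E : Set (Finset V)) ∧ G ⊆ E := by
  simp [faceChains, Finset.subset_iff, Finset.nonempty_iff_ne_empty]

/-- The `h`-polynomial of the link of the face `G` in the barycentric subdivision of the
simplex `S`. -/
def linkSum (S : Finset V) (G : Finset (Finset V)) : ℝ[X] :=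
  ∑ E ∈ faceChains S G, X ^ (E.card - G.card) * (1 - X) ^ (S.card - E.card)

/-- The subdivided simplex is a cone with apex the barycenter of `S`. If `S ∉ G`, the chains `E` and
`insert S E` have weights `(1-X)w` and `Xw`, which add up to `w`; if `S ∈ G`, only `insert S E`
refines `G`. -/
lemma linkSum_eq_chainSum {S : Finset V} (hS : S ≠ ∅) {G : Finset (Finset V)} :
    linkSum S G = chainSum ∅ S (G.erase S) := by
  have hS' : ∅ ⊂ S := Finset.empty_ssubset.2 (Finset.nonempty_iff_ne_empty.2 hS)
  have hIoc : Finset.Ioc ∅ S = insert S (Finset.Ioo ∅ S) :=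
    (Finset.Ioo_insert_right hS').symm
  have hnot : ∀ E ∈ (Finset.Ioo ∅ S).powerset, S ∉ E := fun E hE h =>
    (Finset.mem_Ioo.1 (Finset.mem_powerset.1 hE h)).2.ne rfl
  rw [linkSum, chainSum, faceChains, chainsBetween, hIoc, Finset.sum_filter, Finset.sum_filter,
    Finset.sum_powerset_insert (by simp), ← Finset.sum_add_distrib]
  refine Finset.sum_congr rfl fun E hE => ?_
  have hSE := hnot E hE
  have hlt : ∀ U ∈ E, ∅ ⊂ U ∧ U ⊂ S := fun U hU =>
    Finset.mem_Ioo.1 (Finset.mem_powerset.1 hE hU)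
  have hch : IsChain (· ⊆ ·) ((insert S E : Finset (Finset V)) : Set (Finset V)) ↔
      IsChain (· ⊆ ·) (E : Set (Finset V)) :=
    ⟨fun h => h.mono (Finset.coe_subset.2 (Finset.subset_insert _ _)),
      fun h => isChain_insert_top h fun U hU => (hlt U hU).2.subset⟩
  have hcond : (IsChain (· ⊆ ·) ((insert S E : Finset (Finset V)) : Set (Finset V)) ∧
      G ⊆ insert S E) ↔ IsChain (· ⊆ ·) (E : Set (Finset V)) ∧ G.erase S ⊆ E := by
    rw [hch, Finset.subset_insert_iff]
  rw [Finset.card_insert_of_notMem hSE]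
  by_cases hcG : IsChain (· ⊆ ·) (E : Set (Finset V)) ∧ G.erase S ⊆ E
  swap
  · rw [if_neg hcG, if_neg (mt hcond.1 hcG), if_neg, add_zero]
    exact fun h => hcG ⟨h.1, (Finset.erase_subset _ _).trans h.2⟩
  rw [if_pos hcG, if_pos (hcond.2 hcG)]
  obtain ⟨hc, hG⟩ := hcG
  have b := card_chain_le hc hlt
  have bG := Finset.card_le_card hG
  have d := Finset.card_lt_card hS'
  simp only [Finset.card_empty, Nat.sub_zero] at b d ⊢
  by_cases hSG : S ∈ G
  · have : ¬ G ⊆ E := fun h => hSE (h hSG)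
    have e := Finset.card_erase_add_one hSG
    rw [if_neg fun h => this h.2, zero_add]
    congr 2 <;> omega
  · rw [Finset.erase_eq_of_notMem hSG] at hG bG ⊢
    rw [if_pos ⟨hc, hG⟩, show S.card - E.card = S.card - 1 - E.card + 1 by omega,
      show E.card + 1 - G.card = E.card - G.card + 1 by omega,
      show S.card - (E.card + 1) = S.card - 1 - E.card by omega]
    ring

lemma linkSum_empty (S : Finset V) : linkSum S ∅ = eulerPoly S.card := by
  rcases eq_or_ne S ∅ with rfl | hS
  · have : faceChains (∅ : Finset V) ∅ = {∅} := by simp [faceChains]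
    simp [linkSum, this, eulerPoly_zero]
  · rw [linkSum_eq_chainSum hS, Finset.erase_empty,
      chainSum_empty ∅ (Finset.empty_ssubset.2 (Finset.nonempty_iff_ne_empty.2 hS))]
    simp

/-- The set `S` enters only through the last gap, so an alternating sum over `S ⊇ T` becomes a
binomial transform of Eulerian polynomials. -/
lemma linkSum_eq_mul {S T : Finset V} {G : Finset (Finset V)}
    (hG : IsChain (· ⊆ ·) (G : Set (Finset V))) (hT : T ∈ G) (hmax : ∀ U ∈ G, U ⊆ T)
    (hne : T ≠ ∅) (hTS : T ⊆ S) :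
    linkSum S G = chainSum ∅ T (G.erase T) * eulerPoly (S.card - T.card) := by
  have hT0 : ∅ ⊂ T := Finset.empty_ssubset.2 (Finset.nonempty_iff_ne_empty.2 hne)
  rcases eq_or_ne T S with rfl | hTS'
  · rw [linkSum_eq_chainSum hne, Nat.sub_self, eulerPoly_zero, mul_one]
  · have hss := hTS.ssubset_of_ne hTS'
    have hSG : S ∉ G := fun h => hss.2 (hmax S h)
    have h1 : G.filter (· ⊂ T) = G.erase T := by
      ext U
      simp only [Finset.mem_filter, Finset.mem_erase]
      exact ⟨fun h => ⟨h.2.ne, h.1⟩, fun h => ⟨h.2, (hmax U h.2).ssubset_of_ne h.1⟩⟩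
    have h2 : G.filter (T ⊂ ·) = ∅ :=
      Finset.filter_eq_empty_iff.2 fun U hU h => h.2 (hmax U hU)
    rw [linkSum_eq_chainSum (fun h => by simp [h] at hss), Finset.erase_eq_of_notMem hSG,
      chainSum_split hG hT hT0 hss, h1, h2, chainSum_empty T hss]

/-- The relative local `h`-polynomials of the barycentric subdivision of a simplex are
`γ`-positive. -/
lemma sum_linkSum_mem_gammaCone [Fintype V] {G : Finset (Finset V)}
    (hG : IsChain (· ⊆ ·) (G : Set (Finset V))) (h0 : ∅ ∉ G) :
    ∑ S ∈ Finset.univ.filter (fun S : Finset V => ∀ U ∈ G, U ⊆ S),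
      (-1) ^ (Fintype.card V - S.card) * linkSum S G ∈
        gammaCone (Fintype.card V - G.card) := by
  -- The empty chain is treated uniformly by taking `T = ∅` and `c = 1`.
  obtain ⟨T, c, hcard, hc, hfil, hlink⟩ : ∃ (T : Finset V) (c : ℝ[X]),
      G.card ≤ T.card ∧ c ∈ gammaCone (T.card - G.card) ∧
      (∀ S, (∀ U ∈ G, U ⊆ S) ↔ T ⊆ S) ∧
      ∀ S, T ⊆ S → linkSum S G = c * eulerPoly (S.card - T.card) := by
    rcases G.eq_empty_or_nonempty with rfl | hne
    · exact ⟨∅, 1, le_rfl, one_mem_gammaCone, by simp, by simp [linkSum_empty]⟩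
    · obtain ⟨T, hT, hmax⟩ := exists_top_of_chain hG hne
      have hT0 : T ≠ ∅ := fun h => h0 (h ▸ hT)
      have hb : ∀ U ∈ G.erase T, ∅ ⊂ U ∧ U ⊂ T := fun U hU => by
        obtain ⟨h1, h2⟩ := Finset.mem_erase.1 hU
        exact ⟨Finset.empty_ssubset.2 (Finset.nonempty_iff_ne_empty.2 fun h => h0 (h ▸ h2)),
          (hmax U h2).ssubset_of_ne h1⟩
      have hch : IsChain (· ⊆ ·) ((G.erase T : Finset (Finset V)) : Set (Finset V)) :=
        hG.mono (Finset.coe_subset.2 (Finset.erase_subset _ _))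
      have hT0' : ∅ ⊂ T := Finset.empty_ssubset.2 (Finset.nonempty_iff_ne_empty.2 hT0)
      have hle := card_chain_le hch hb
      have he := Finset.card_erase_add_one hT
      have hpos := Finset.card_lt_card hT0'
      simp only [Finset.card_empty] at hle hpos
      refine ⟨T, chainSum ∅ T (G.erase T), by omega, ?_,
        fun S => ⟨fun h => h T hT, fun h U hU => (hmax U hU).trans h⟩,
        fun S hS => linkSum_eq_mul hG hT hmax hT0 hS⟩
      have := chainSum_mem_gammaCone hT0' hch hb
      convert this using 2
      simp only [Finset.card_empty]
      omega
  have hset : Finset.univ.filter (fun S : Finset V => ∀ U ∈ G, U ⊆ S) =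
      Finset.Icc T Finset.univ := by
    ext S
    simp [hfil S]
  have hsum : ∑ S ∈ Finset.univ.filter (fun S : Finset V => ∀ U ∈ G, U ⊆ S),
      (-1) ^ (Fintype.card V - S.card) * linkSum S G =
      c * eulerTransform (-1) (Fintype.card V - T.card) := by
    rw [hset, ← Finset.card_univ, ← sum_Icc_eulerPoly (-1) (Finset.subset_univ T), Finset.mul_sum]
    refine Finset.sum_congr rfl fun S hS => ?_
    rw [hlink S (Finset.mem_Icc.1 hS).1]
    ring
  rw [hsum]
  have hTV : T.card ≤ Fintype.card V := Finset.card_le_univ T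
  convert mul_mem_gammaCone hc (eulerTransform_neg_one_mem_gammaCone _) using 2
  omega

end Chains

/-! ### Simplicial cones and fans -/

section Fans

variable {ι E : Type*} [AddCommGroup E] [Module ℝ E]

/-- The closed cone generated by the vectors `b i`, `i ∈ s`. -/
def cone (b : ι → E) (s : Finset ι) : Set E :=
  {x | ∃ c : ι → ℝ, (∀ i ∈ s, 0 ≤ c i) ∧ ∑ i ∈ s, c i • b i = x}

/-- The positive combinations of the vectors `b i`, `i ∈ s`. -/
def openCone (b : ι → E) (s : Finset ι) : Set E :=
  {x | ∃ c : ι → ℝ, (∀ i ∈ s, 0 < c i) ∧ ∑ i ∈ s, c i • b i = x}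

lemma openCone_subset_cone (b : ι → E) (s : Finset ι) : openCone b s ⊆ cone b s :=
  fun _ ⟨c, hc, h⟩ => ⟨c, fun i hi => (hc i hi).le, h⟩

lemma zero_mem_cone (b : ι → E) (s : Finset ι) : 0 ∈ cone b s :=
  ⟨0, fun _ _ => le_rfl, by simp⟩

lemma add_mem_cone {b : ι → E} {s : Finset ι} {x y : E} (hx : x ∈ cone b s) (hy : y ∈ cone b s) :
    x + y ∈ cone b s := by
  obtain ⟨c, hc, rfl⟩ := hx
  obtain ⟨d, hd, rfl⟩ := hy
  exact ⟨c + d, fun i hi => add_nonneg (hc i hi) (hd i hi), by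
    simp [add_smul, Finset.sum_add_distrib]⟩

lemma smul_mem_cone {b : ι → E} {s : Finset ι} {r : ℝ} (hr : 0 ≤ r) {x : E}
    (hx : x ∈ cone b s) : r • x ∈ cone b s := by
  obtain ⟨c, hc, rfl⟩ := hx
  exact ⟨r • c, fun i hi => mul_nonneg hr (hc i hi), by simp [Finset.smul_sum, mul_smul]⟩

lemma sum_mem_cone {κ : Type*} {b : ι → E} {s : Finset ι} {t : Finset κ} {f : κ → E}
    (h : ∀ k ∈ t, f k ∈ cone b s) : ∑ k ∈ t, f k ∈ cone b s :=
  Finset.sum_induction f (· ∈ cone b s) (fun _ _ => add_mem_cone) (zero_mem_cone b s) h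

lemma cone_mono {b : ι → E} {s t : Finset ι} (h : s ⊆ t) : cone b s ⊆ cone b t := by
  classical
  rintro x ⟨c, hc, rfl⟩
  refine ⟨fun i => if i ∈ s then c i else 0, fun i _ => ?_, ?_⟩
  · dsimp only
    split_ifs with hi
    exacts [hc i hi, le_rfl]
  · simp only [ite_smul, zero_smul, Finset.sum_ite_mem, Finset.inter_eq_right.2 h]

lemma mem_cone_of_mem {b : ι → E} {s : Finset ι} {i : ι} (hi : i ∈ s) : b i ∈ cone b s :=
  cone_mono (Finset.singleton_subset_iff.2 hi) ⟨1, by simp, by simp⟩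

lemma cone_subset_cone {κ : Type*} {b : ι → E} {s : Finset ι} {d : κ → E} {t : Finset κ}
    (h : ∀ k ∈ t, d k ∈ cone b s) : cone d t ⊆ cone b s := by
  rintro x ⟨c, hc, rfl⟩
  exact sum_mem_cone fun k hk => smul_mem_cone (hc k hk) (h k hk)

lemma cone_subset_span (b : ι → E) (s : Finset ι) :
    cone b s ⊆ Submodule.span ℝ (b '' (s : Set ι)) := by
  rintro x ⟨c, -, rfl⟩
  exact Submodule.sum_mem _ fun i hi =>
    Submodule.smul_mem _ _ (Submodule.subset_span (Set.mem_image_of_mem _ hi))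

lemma exists_openCone_of_mem_cone {b : ι → E} {s : Finset ι} {x : E} (hx : x ∈ cone b s) :
    ∃ t ⊆ s, x ∈ openCone b t := by
  classical
  obtain ⟨c, hc, rfl⟩ := hx
  refine ⟨s.filter fun i => c i ≠ 0, Finset.filter_subset _ _, c, ?_, ?_⟩
  · intro i hi
    obtain ⟨h1, h2⟩ := Finset.mem_filter.1 hi
    exact lt_of_le_of_ne (hc i h1) (Ne.symm h2)
  · refine Finset.sum_filter_of_ne fun i _ h h0 => h (by simp [h0])

lemma sum_mem_openCone (s : Finset E) : ∑ v ∈ s, v ∈ openCone id s :=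
  ⟨1, by simp, by simp⟩

lemma coeff_eq_of_sum_eq {b : ι → E} {s : Finset ι} (hs : LinearIndepOn ℝ b (s : Set ι))
    {c d : ι → ℝ} (h : ∑ i ∈ s, c i • b i = ∑ i ∈ s, d i • b i) : ∀ i ∈ s, c i = d i := by
  intro i hi
  refine sub_eq_zero.1 (linearIndepOn_finset_iff.1 hs (fun i => c i - d i) ?_ i hi)
  simp [sub_smul, Finset.sum_sub_distrib, h]

/-- The cone over a face of a simplex is a face of the cone over the simplex. -/
lemma mem_cone_of_openCone_mem {κ : Type*} {b : ι → E} {t F : Finset ι}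
    (ht : LinearIndepOn ℝ b (t : Set ι)) (hF : F ⊆ t) {d : κ → E} {s : Finset κ}
    (hs : ∀ k ∈ s, d k ∈ cone b t) {x : E} (hx : x ∈ openCone d s) (hxF : x ∈ cone b F) :
    ∀ k ∈ s, d k ∈ cone b F := by
  classical
  choose! a ha0 ha using hs
  obtain ⟨c, hc, rfl⟩ := hx
  obtain ⟨e, he, hex⟩ := hxF
  have h1 : ∑ i ∈ t, (∑ k ∈ s, c k * a k i) • b i =
      ∑ i ∈ t, (if i ∈ F then e i else 0) • b i := by
    simp only [ite_smul, zero_smul, Finset.sum_ite_mem, Finset.inter_eq_right.2 hF, hex]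
    simp only [Finset.sum_smul, mul_smul]
    rw [Finset.sum_comm]
    refine Finset.sum_congr rfl fun k hk => ?_
    rw [← Finset.smul_sum, ha k hk]
  have h2 := coeff_eq_of_sum_eq ht h1
  intro k hk
  refine ⟨a k, fun i hi => ha0 k hk i (hF hi), ?_⟩
  rw [← ha k hk]
  refine Finset.sum_subset hF fun i hi hiF => ?_
  have h3 := h2 i hi
  rw [if_neg hiF, Finset.sum_eq_zero_iff_of_nonneg
    (fun k hk => mul_nonneg (hc k hk).le (ha0 k hk i hi))] at h3
  rw [(mul_eq_zero.1 (h3 k hk)).resolve_left (hc k hk).ne', zero_smul]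

lemma span_le_of_subset_cone {b : ι → E} {W : Finset ι} {s : Finset E} (hs : ∀ v ∈ s, v ∈ cone b W) :
    Submodule.span ℝ (s : Set E) ≤ Submodule.span ℝ (b '' (W : Set ι)) :=
  Submodule.span_le.2 fun v hv => cone_subset_span b W (hs v hv)

/-- Two points `e + ε z` of a subspace determine `e` and `z`. -/
lemma mem_of_frequently_add_smul_mem {p : Submodule ℝ E} {e z : E}
    (h : ∃ᶠ ε in 𝓝[>] (0 : ℝ), e + ε • z ∈ p) : e ∈ p ∧ z ∈ p := by
  obtain ⟨ε₁, h1, hε₁⟩ := (h.and_eventually self_mem_nhdsWithin).exists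
  obtain ⟨ε₂, h2, hε₂⟩ := (h.and_eventually (Ioo_mem_nhdsGT hε₁)).exists
  have hz : z ∈ p := by
    have h3 := p.sub_mem h1 h2
    rw [add_sub_add_left_eq_sub, ← sub_smul] at h3
    exact (p.smul_mem_iff (sub_pos.2 hε₂.2).ne').1 h3
  exact ⟨(p.add_mem_iff_left (p.smul_mem _ hz)).1 h1, hz⟩

/-- In the coordinates given by `b`, each span to be avoided pulls back to a proper subspace, by
dimension, hence to a null set. Finitely many null sets cannot cover the open positive orthant. -/
lemma exists_generic_mem_openCone {b : ι → E} {W : Finset ι}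
    (hW : LinearIndepOn ℝ b (W : Set ι)) (𝒮 : Finset (Finset E)) :
    ∃ q ∈ openCone b W, ∀ s ∈ 𝒮, s.card < W.card → q ∉ Submodule.span ℝ (s : Set E) := by
  classical
  let L : (W → ℝ) →ₗ[ℝ] E := Fintype.linearCombination ℝ fun i : W => b i
  have hL : Function.Injective L := LinearIndependent.fintypeLinearCombination_injective hW
  let U : Set (W → ℝ) := Set.univ.pi fun _ => Set.Ioi 0
  have hU : IsOpen U := isOpen_set_pi Set.finite_univ fun _ _ => isOpen_Ioi
  have hpos : 0 < MeasureTheory.volume U :=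
    hU.measure_pos _ ⟨fun _ => 1, fun _ _ => Set.mem_Ioi.2 one_pos⟩
  let 𝒯 := 𝒮.filter fun s => s.card < W.card
  have hnull : MeasureTheory.volume
      (⋃ s ∈ 𝒯, (((Submodule.span ℝ (s : Set E)).comap L : Submodule ℝ (W → ℝ)) :
        Set (W → ℝ))) = 0 := by
    refine (MeasureTheory.measure_biUnion_null_iff (I := (𝒯 : Set (Finset E)))
      𝒯.countable_toSet).2 fun s hs => ?_
    refine MeasureTheory.Measure.addHaar_submodule _ _ fun htop => ?_
    have hcard := (Finset.mem_filter.1 hs).2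
    have hle : LinearMap.range L ≤ Submodule.span ℝ (s : Set E) := by
      rintro _ ⟨c, rfl⟩
      exact (htop ▸ Submodule.mem_top : c ∈ (Submodule.span ℝ (s : Set E)).comap L)
    have h1 := Submodule.finrank_mono hle
    rw [LinearMap.finrank_range_of_inj hL, Module.finrank_fintype_fun_eq_card,
      Fintype.card_coe] at h1
    have h2 : Module.finrank ℝ (Submodule.span ℝ (s : Set E)) ≤ s.card :=
      finrank_span_finset_le_card s
    omega
  obtain ⟨c, hcU, hc⟩ : ∃ c ∈ U, c ∉ ⋃ s ∈ 𝒯,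
      (((Submodule.span ℝ (s : Set E)).comap L : Submodule ℝ (W → ℝ)) : Set (W → ℝ)) := by
    by_contra! h
    exact hpos.ne' (MeasureTheory.measure_mono_null h hnull)
  refine ⟨L c, ⟨fun i => if hi : i ∈ W then c ⟨i, hi⟩ else 0, fun i hi => ?_, ?_⟩,
    fun s hs hlt hmem => hc ?_⟩
  · simp only [dif_pos hi]
    exact hcU ⟨i, hi⟩ trivial
  · rw [← Finset.sum_attach]
    simp [L, Fintype.linearCombination_apply]
  · exact Set.mem_biUnion (x := s) (Finset.mem_filter.2 ⟨hs, hlt⟩) hmem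

lemma add_smul_mem_cone_of_mem {b : ι → E} {W : Finset ι} {x y : E} (hx : x ∈ cone b W) (hy : y ∈ cone b W) :
    ∀ᶠ ε in 𝓝[>] (0 : ℝ), x + ε • y ∈ cone b W := by
  filter_upwards [self_mem_nhdsWithin] with ε hε
  exact add_mem_cone hx (smul_mem_cone (le_of_lt hε) hy)

/-- The coefficients of `x - ε q` are `a i - ε c i` with `c i > 0`. They stay nonnegative for small
`ε > 0` exactly when no `a i` vanishes. -/
lemma eventually_add_smul_neg_mem_cone_iff {b : ι → E} {W : Finset ι} (hW : LinearIndepOn ℝ b (W : Set ι)) {x q : E}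
    (hx : x ∈ cone b W) (hq : q ∈ openCone b W) :
    (∀ᶠ ε in 𝓝[>] (0 : ℝ), x + ε • -q ∈ cone b W) ↔ x ∈ openCone b W := by
  obtain ⟨a, -, rfl⟩ := hx
  obtain ⟨c, hc, rfl⟩ := hq
  have hsum : ∀ ε : ℝ, ∑ i ∈ W, a i • b i + ε • -∑ i ∈ W, c i • b i =
      ∑ i ∈ W, (a i - ε * c i) • b i := by
    intro ε
    simp only [sub_smul, mul_smul, Finset.sum_sub_distrib, ← Finset.smul_sum, smul_neg]
    rw [← sub_eq_add_neg]
  constructor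
  · intro hev
    obtain ⟨ε, ⟨d, hd0, hd⟩, hε⟩ := (hev.and self_mem_nhdsWithin).exists
    rw [hsum] at hd
    refine ⟨a, fun i hi => ?_, rfl⟩
    have h1 := coeff_eq_of_sum_eq hW hd i hi
    have h2 := hd0 i hi
    have h3 := mul_pos (Set.mem_Ioi.1 hε) (hc i hi)
    linarith
  · rintro ⟨a', ha', h⟩
    have ha : ∀ i ∈ W, 0 < a i := fun i hi => coeff_eq_of_sum_eq hW h i hi ▸ ha' i hi
    have hev : ∀ i ∈ W, ∀ᶠ ε in 𝓝[>] (0 : ℝ), 0 < a i - ε * c i := by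
      intro i hi
      have : Tendsto (fun ε : ℝ => a i - ε * c i) (𝓝[>] 0) (𝓝 (a i - 0 * c i)) :=
        (tendsto_const_nhds.sub (tendsto_id.mul tendsto_const_nhds)).mono_left nhdsWithin_le_nhds
      exact this.eventually (lt_mem_nhds (by simpa using ha i hi))
    filter_upwards [(Finset.eventually_all W).2 hev] with ε hε
    exact ⟨_, fun i hi => (hε i hi).le, (hsum ε).symm⟩

variable [DecidableEq E]

/-- The finite set `𝒮` of sets of vectors generates a simplicial fan with support the
cone generated by the vectors `b i`, `i ∈ W`. -/
structure IsFan (𝒮 : Finset (Finset E)) (b : ι → E) (W : Finset ι) : Prop where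
  down_closed : ∀ s ∈ 𝒮, ∀ t ⊆ s, t ∈ 𝒮
  indep : ∀ s ∈ 𝒮, LinearIndepOn ℝ id (s : Set E)
  inter : ∀ s ∈ 𝒮, ∀ t ∈ 𝒮, cone id s ∩ cone id t ⊆ cone (id : E → E) (s ∩ t)
  cover : ∀ x ∈ cone b W, ∃ s ∈ 𝒮, x ∈ cone id s
  mem_cone : ∀ s ∈ 𝒮, ∀ v ∈ s, v ∈ cone b W

/-! ### Half-open decompositions and the Dehn–Sommerville relations -/

section Fan

variable {𝒮 : Finset (Finset E)} {b : ι → E} {W : Finset ι}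

lemma finrank_span_image_eq_card (hW : LinearIndepOn ℝ b (W : Set ι)) :
    Module.finrank ℝ (Submodule.span ℝ (b '' (W : Set ι))) = W.card := by
  classical
  rw [← Finset.coe_image, finrank_span_finset_eq_card (by
    rw [Finset.coe_image]; exact hW.id_image), Finset.card_image_of_injOn hW.injOn]

lemma card_le_of_subset_cone (hW : LinearIndepOn ℝ b (W : Set ι)) {s : Finset E}
    (hi : LinearIndepOn ℝ id (s : Set E)) (hs : ∀ v ∈ s, v ∈ cone b W) : s.card ≤ W.card := by
  have : FiniteDimensional ℝ (Submodule.span ℝ (b '' (W : Set ι))) :=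
    FiniteDimensional.span_of_finite ℝ (W.finite_toSet.image b)
  rw [← finrank_span_finset_eq_card hi, ← finrank_span_image_eq_card hW]
  exact Submodule.finrank_mono (span_le_of_subset_cone hs)

lemma IsFan.mem_span (h : IsFan 𝒮 b W) (hW : LinearIndepOn ℝ b (W : Set ι)) {t : Finset E}
    (ht : t ∈ 𝒮) (hc : t.card = W.card) {x : E} (hx : x ∈ Submodule.span ℝ (b '' (W : Set ι))) :
    x ∈ Submodule.span ℝ (t : Set E) := by
  have : FiniteDimensional ℝ (Submodule.span ℝ (b '' (W : Set ι))) :=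
    FiniteDimensional.span_of_finite ℝ (W.finite_toSet.image b)
  rwa [Submodule.eq_of_le_of_finrank_eq (span_le_of_subset_cone (h.mem_cone t ht)) (by
    rw [finrank_span_finset_eq_card (h.indep t ht), finrank_span_image_eq_card hW, hc])]

/-- A vector is generic for a family of cones if it lies in no span of fewer than `n` generators
of one of the cones. -/
def IsGeneric (𝒮 : Finset (Finset E)) (n : ℕ) (z : E) : Prop :=
  ∀ s ∈ 𝒮, s.card < n → z ∉ Submodule.span ℝ (s : Set E)

lemma IsFan.coeff_ne_zero (h : IsFan 𝒮 b W) {z : E} (hz : IsGeneric 𝒮 W.card z) {t : Finset E}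
    (ht : t ∈ 𝒮) (hc : t.card = W.card) {c : E → ℝ} (hcz : ∑ v ∈ t, c v • v = z) :
    ∀ v ∈ t, c v ≠ 0 := by
  intro v hv h0
  refine hz (t.erase v) (h.down_closed t ht _ (Finset.erase_subset _ _))
    (by rw [← hc]; exact Finset.card_erase_lt_of_mem hv) ?_
  rw [← hcz, ← Finset.add_sum_erase _ _ hv, h0, zero_smul, zero_add]
  exact Submodule.sum_mem _ fun u hu => Submodule.smul_mem _ _ (Submodule.subset_span hu)

lemma sum_add_smul_mem_cone {s t : Finset E} (hst : s ⊆ t) {c : E → ℝ} {z : E}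
    (hcz : ∑ v ∈ t, c v • v = z) (hpos : ∀ v ∈ t \ s, 0 < c v) :
    ∀ᶠ ε in 𝓝[>] (0 : ℝ), ∑ v ∈ s, v + ε • z ∈ cone id t := by
  have hev : ∀ v ∈ s, ∀ᶠ ε in 𝓝[>] (0 : ℝ), 0 < 1 + ε * c v := by
    intro v _
    have : Tendsto (fun ε : ℝ => 1 + ε * c v) (𝓝[>] 0) (𝓝 (1 + 0 * c v)) :=
      (tendsto_const_nhds.add (tendsto_id.mul tendsto_const_nhds)).mono_left nhdsWithin_le_nhds
    exact this.eventually (lt_mem_nhds (by simp))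
  filter_upwards [(Finset.eventually_all s).2 hev, self_mem_nhdsWithin] with ε hε hε0
  refine ⟨fun v => (if v ∈ s then 1 else 0) + ε * c v, fun v hv => ?_, ?_⟩
  · dsimp only
    split_ifs with hvs
    · exact (hε v hvs).le
    · rw [zero_add]
      exact mul_nonneg (le_of_lt hε0) (hpos v (Finset.mem_sdiff.2 ⟨hv, hvs⟩)).le
  · simp only [add_smul, Finset.sum_add_distrib, mul_smul, ← Finset.smul_sum, id, hcz, ite_smul,
      zero_smul, one_smul, Finset.sum_ite_mem, Finset.inter_eq_right.2 hst]

/-- With `e = ∑ v ∈ s, v`, one of the finitely many cones, say `t`, contains `e + ε z` for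
arbitrarily small `ε`. Its span contains `z`, so genericity makes `t` full-dimensional. Letting `ε →
0` puts `e` in the cone of `t`, and the intersection property then gives `s ⊆ t`. Outside `s` the
coefficients of `e` vanish, so those of `z` are nonnegative there, and nonzero by genericity. -/
lemma IsFan.exists_of_eventually (h : IsFan 𝒮 b W) {z : E} (hz : IsGeneric 𝒮 W.card z)
    (hW : LinearIndepOn ℝ b (W : Set ι)) {s : Finset E} (hs : s ∈ 𝒮)
    (hev : ∀ᶠ ε in 𝓝[>] (0 : ℝ), ∑ v ∈ s, v + ε • z ∈ cone b W) :
    ∃ t ∈ 𝒮, t.card = W.card ∧ s ⊆ t ∧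
      ∃ c : E → ℝ, ∑ v ∈ t, c v • v = z ∧ ∀ v ∈ t \ s, 0 < c v := by
  obtain ⟨t, ht, hfr⟩ : ∃ t ∈ 𝒮, ∃ᶠ ε in 𝓝[>] (0 : ℝ), ∑ v ∈ s, v + ε • z ∈ cone id t :=
    (frequently_exists_finset 𝒮).1 (hev.mono fun ε hε => h.cover _ hε).frequently
  obtain ⟨he, hzt⟩ := mem_of_frequently_add_smul_mem (p := Submodule.span ℝ (t : Set E))
    (hfr.mono fun ε hε => by simpa using cone_subset_span id t hε)
  have hcard : t.card = W.card := le_antisymm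
    (card_le_of_subset_cone hW (h.indep t ht) (h.mem_cone t ht))
    (not_lt.1 fun hlt => hz t ht hlt hzt)
  obtain ⟨d, -, hd⟩ := Submodule.mem_span_finset.1 he
  obtain ⟨c, -, hc⟩ := Submodule.mem_span_finset.1 hzt
  have hfr' : ∃ᶠ ε in 𝓝[>] (0 : ℝ), ∀ v ∈ t, 0 ≤ d v + ε * c v := by
    refine hfr.mono ?_
    rintro ε ⟨a, ha0, ha⟩ v hv
    have h1 : ∑ v ∈ t, a v • id v = ∑ v ∈ t, (d v + ε * c v) • id v := by
      rw [ha]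
      simp only [add_smul, Finset.sum_add_distrib, mul_smul, ← Finset.smul_sum, id, hc, hd]
    rw [← coeff_eq_of_sum_eq (h.indep t ht) h1 v hv]
    exact ha0 v hv
  have hd0 : ∀ v ∈ t, 0 ≤ d v := by
    intro v hv
    by_contra! hneg
    have : Tendsto (fun ε : ℝ => d v + ε * c v) (𝓝[>] 0) (𝓝 (d v + 0 * c v)) :=
      (tendsto_const_nhds.add (tendsto_id.mul tendsto_const_nhds)).mono_left nhdsWithin_le_nhds
    obtain ⟨ε, h1, h2⟩ := (hfr'.and_eventually
      (this.eventually (gt_mem_nhds (by simpa using hneg)))).exists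
    exact (h1 v hv).not_gt h2
  have hst : s ⊆ t := by
    obtain ⟨a, ha0, ha⟩ := h.inter s hs t ht
      ⟨openCone_subset_cone _ _ (sum_mem_openCone s), ⟨d, hd0, hd⟩⟩
    have h1 : ∑ v ∈ s, (1 : E → ℝ) v • id v = ∑ v ∈ s, (if v ∈ s ∩ t then a v else 0) • id v := by
      simp only [ite_smul, zero_smul, Finset.sum_ite_mem]
      rw [← Finset.inter_assoc, Finset.inter_self, ha]
      simp
    intro v hv
    have h2 := coeff_eq_of_sum_eq (h.indep s hs) h1 v hv
    by_contra hvt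
    simp [hvt] at h2
  refine ⟨t, ht, hcard, hst, c, hc, fun v hv => ?_⟩
  obtain ⟨hvt, hvs⟩ := Finset.mem_sdiff.1 hv
  have hdv : d v = 0 := by
    have h1 : ∑ v ∈ t, d v • id v = ∑ v ∈ t, (if v ∈ s then (1 : ℝ) else 0) • id v := by
      simp only [ite_smul, zero_smul, Finset.sum_ite_mem, Finset.inter_eq_right.2 hst, one_smul,
        id, hd]
    simpa [hvs] using coeff_eq_of_sum_eq (h.indep t ht) h1 v hvt
  obtain ⟨ε, h1, hε⟩ := (hfr'.and_eventually self_mem_nhdsWithin).exists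
  have h2 := h1 v hvt
  rw [hdv, zero_add] at h2
  exact lt_of_le_of_ne (nonneg_of_mul_nonneg_right h2 hε)
    (h.coeff_ne_zero hz ht hcard hc v hvt).symm

/-- Both cones contain `e + ε z` for small `ε`, with `e` the sum of `s`, so `z` lies in the span of
`t ∩ t'`. Genericity forbids this unless `t ∩ t'` has full cardinality. -/
lemma IsFan.eq_of_pos (h : IsFan 𝒮 b W) {z : E} (hz : IsGeneric 𝒮 W.card z)
    {s t t' : Finset E} (ht : t ∈ 𝒮) (ht' : t' ∈ 𝒮) (hc : t.card = W.card)
    (hc' : t'.card = W.card) (hst : s ⊆ t) (hst' : s ⊆ t')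
    {c c' : E → ℝ} (hcz : ∑ v ∈ t, c v • v = z) (hcz' : ∑ v ∈ t', c' v • v = z)
    (hpos : ∀ v ∈ t \ s, 0 < c v) (hpos' : ∀ v ∈ t' \ s, 0 < c' v) : t = t' := by
  have hev : ∀ᶠ ε in 𝓝[>] (0 : ℝ), ∑ v ∈ s, v + ε • z ∈
      Submodule.span ℝ ((t ∩ t' : Finset E) : Set E) := by
    filter_upwards [sum_add_smul_mem_cone hst hcz hpos, sum_add_smul_mem_cone hst' hcz' hpos']
      with ε h1 h2
    simpa using cone_subset_span id _ (h.inter t ht t' ht' ⟨h1, h2⟩)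
  have hcard : W.card ≤ (t ∩ t').card := not_lt.1 fun hlt =>
    hz _ (h.down_closed t ht _ Finset.inter_subset_left) hlt
      (mem_of_frequently_add_smul_mem hev.frequently).2
  rw [← Finset.eq_of_subset_of_card_le Finset.inter_subset_left (hc.trans_le hcard),
    Finset.eq_of_subset_of_card_le Finset.inter_subset_right (hc'.trans_le hcard)]

lemma sum_Icc_pow {α : Type*} [DecidableEq α] {R t : Finset α} (h : R ⊆ t) :
    ∑ s ∈ Finset.Icc R t, (X : ℝ[X]) ^ s.card * (1 - X) ^ (t.card - s.card) = X ^ R.card := by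
  have h1 := sum_Icc_pow_mul_pow (X : ℝ[X]) (1 - X) h
  rw [add_sub_cancel, one_pow] at h1
  refine Eq.trans ?_ ((congrArg (X ^ R.card * ·) h1).trans (mul_one _))
  rw [Finset.mul_sum]
  refine Finset.sum_congr rfl fun s hs => ?_
  rw [← mul_assoc, ← pow_add,
    Nat.add_sub_cancel' (Finset.card_le_card (Finset.mem_Icc.1 hs).1)]

open Classical in
/-- The half-open decomposition of a fan with respect to a generic direction `z`. -/
lemma IsFan.sum_eq_of_generic (h : IsFan 𝒮 b W) (hW : LinearIndepOn ℝ b (W : Set ι)) {z : E}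
    (hz : IsGeneric 𝒮 W.card z) {c : Finset E → E → ℝ}
    (hc : ∀ t ∈ 𝒮, t.card = W.card → ∑ v ∈ t, c t v • v = z) :
    ∑ s ∈ 𝒮.filter (fun s => ∀ᶠ ε in 𝓝[>] (0 : ℝ), ∑ v ∈ s, v + ε • z ∈ cone b W),
        (X : ℝ[X]) ^ s.card * (1 - X) ^ (W.card - s.card) =
      ∑ t ∈ 𝒮.filter (fun t => t.card = W.card), X ^ (t.filter fun v => c t v ≤ 0).card := by
  -- With `R t` the set of generators of `t` having nonpositive coefficient in `z`, the faces
  -- assigned to `t` form the interval from `R t` to `t`. Their weights sum to `X ^ |R t|`.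
  have hsub : ∀ {s t : Finset E}, t.filter (fun v => c t v ≤ 0) ⊆ s ↔ ∀ v ∈ t \ s, 0 < c t v := by
    intro s t
    simp only [Finset.subset_iff, Finset.mem_filter, Finset.mem_sdiff]
    exact ⟨fun h v hv => not_le.1 fun h' => hv.2 (h ⟨hv.1, h'⟩),
      fun h v hv => by_contra fun h' => (h v ⟨hv.1, h'⟩).not_ge hv.2⟩
  have hR : ∀ t ∈ 𝒮.filter (fun t => t.card = W.card),
      (X : ℝ[X]) ^ (t.filter fun v => c t v ≤ 0).card =
      ∑ s ∈ Finset.Icc (t.filter fun v => c t v ≤ 0) t,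
        X ^ s.card * (1 - X) ^ (W.card - s.card) := by
    intro t ht
    rw [← (Finset.mem_filter.1 ht).2, sum_Icc_pow (Finset.filter_subset _ _)]
  rw [Finset.sum_congr rfl hR, Finset.sum_comm'
    (t' := 𝒮.filter (fun s => ∀ᶠ ε in 𝓝[>] (0 : ℝ), ∑ v ∈ s, v + ε • z ∈ cone b W))
    (s' := fun s => 𝒮.filter fun t => t.card = W.card ∧ s ⊆ t ∧ ∀ v ∈ t \ s, 0 < c t v)]
  -- Each admissible `s` lies in the interval of exactly one full-dimensional `t`.
  · refine Finset.sum_congr rfl fun s hs => ?_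
    obtain ⟨hs, hev⟩ := Finset.mem_filter.1 hs
    obtain ⟨t, ht, hcard, hst, d, hd, hpos⟩ := h.exists_of_eventually hz hW hs hev
    have : (𝒮.filter fun t => t.card = W.card ∧ s ⊆ t ∧ ∀ v ∈ t \ s, 0 < c t v) = {t} := by
      ext t'
      simp only [Finset.mem_filter, Finset.mem_singleton]
      constructor
      · rintro ⟨ht', hcard', hst', hpos'⟩
        exact h.eq_of_pos hz ht' ht hcard' hcard hst' hst (hc t' ht' hcard') hd hpos' hpos
      · rintro rfl
        refine ⟨ht, hcard, hst, fun v hv => ?_⟩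
        rw [coeff_eq_of_sum_eq (b := id) (h.indep _ ht) ((hc _ ht hcard).trans hd.symm) v
          (Finset.mem_sdiff.1 hv).1]
        exact hpos v hv
    rw [this, Finset.sum_singleton]
  · intro t s
    simp only [Finset.mem_filter, Finset.mem_Icc, hsub]
    constructor
    · rintro ⟨⟨ht, hcard⟩, hpos, hst⟩
      exact ⟨⟨ht, hcard, hst, hpos⟩, h.down_closed t ht s hst,
        (sum_add_smul_mem_cone hst (hc t ht hcard) hpos).mono fun ε hε =>
          cone_subset_cone (h.mem_cone t ht) hε⟩
    · rintro ⟨⟨ht, hcard, hst, hpos⟩, -, -⟩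
      exact ⟨⟨ht, hcard⟩, hpos, hst⟩

lemma IsFan.empty_mem (h : IsFan 𝒮 b W) : ∅ ∈ 𝒮 := by
  obtain ⟨s, hs, -⟩ := h.cover 0 (zero_mem_cone b W)
  exact h.down_closed s hs _ (Finset.empty_subset s)

lemma IsFan.exists_card_eq (h : IsFan 𝒮 b W) (hW : LinearIndepOn ℝ b (W : Set ι)) :
    ∃ t ∈ 𝒮, t.card = W.card := by
  obtain ⟨q, hq, hgen⟩ := exists_generic_mem_openCone hW 𝒮
  obtain ⟨t, ht, hc, -⟩ := h.exists_of_eventually hgen hW h.empty_mem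
    (add_smul_mem_cone_of_mem (by simpa using zero_mem_cone b W) (openCone_subset_cone _ _ hq))
  exact ⟨t, ht, hc⟩

open Classical in
/-- The Dehn–Sommerville relations for a simplicial subdivision of a simplicial cone. -/
theorem IsFan.reversal (h : IsFan 𝒮 b W) (hW : LinearIndepOn ℝ b (W : Set ι)) {x : ℝ}
    (hx : x ≠ 0) :
    x ^ W.card *
        (∑ s ∈ 𝒮, (X : ℝ[X]) ^ s.card * (1 - X) ^ (W.card - s.card)).eval x⁻¹ =
      (∑ s ∈ 𝒮.filter (fun s => ∑ v ∈ s, v ∈ openCone b W),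
        (X : ℝ[X]) ^ s.card * (1 - X) ^ (W.card - s.card)).eval x := by
  obtain ⟨q, hq, hgen⟩ := exists_generic_mem_openCone hW 𝒮
  have hgen' : IsGeneric 𝒮 W.card (-q) := fun s hs hlt hmem =>
    hgen s hs hlt ((Submodule.neg_mem_iff _).1 hmem)
  have hqspan := cone_subset_span b W (openCone_subset_cone _ _ hq)
  have hex : ∀ t ∈ 𝒮, t.card = W.card → ∃ c : E → ℝ, ∑ v ∈ t, c v • v = q := fun t ht hc =>
    let ⟨c, _, hc'⟩ := Submodule.mem_span_finset.1 (h.mem_span hW ht hc hqspan)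
    ⟨c, hc'⟩
  choose! c hc using hex
  have hsum : ∀ s ∈ 𝒮, ∑ v ∈ s, v ∈ cone b W := fun s hs => sum_mem_cone (h.mem_cone s hs)
  have h1 := h.sum_eq_of_generic hW hgen hc
  have h2 := h.sum_eq_of_generic hW hgen' (c := fun t v => -c t v) (fun t ht ht' => by
    simp only [neg_smul, Finset.sum_neg_distrib, hc t ht ht'])
  -- Moving in direction `q` keeps every face inside the cone; moving in direction `-q` does so only
  -- for faces whose sum of generators is interior.
  rw [Finset.filter_true_of_mem fun s hs =>
    add_smul_mem_cone_of_mem (hsum s hs) (openCone_subset_cone _ _ hq)] at h1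
  rw [Finset.filter_congr fun s hs =>
    eventually_add_smul_neg_mem_cone_iff hW (hsum s hs) hq] at h2
  rw [h1, h2, eval_finsetSum, eval_finsetSum, Finset.mul_sum]
  refine Finset.sum_congr rfl fun t ht => ?_
  obtain ⟨ht, hcard⟩ := Finset.mem_filter.1 ht
  have hne := h.coeff_ne_zero hgen ht hcard (hc t ht hcard)
  -- No coefficient is zero, so the sets of nonpositive coefficients for `q` and `-q` are
  -- complementary in `t`. The substitution of `x⁻¹` for `x` therefore exchanges them.
  have hfil : t.filter (fun v => -c t v ≤ 0) = t.filter fun v => ¬ c t v ≤ 0 :=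
    Finset.filter_congr fun v hv => by
      rw [neg_nonpos, not_le]
      exact ⟨fun h => lt_of_le_of_ne h (hne v hv).symm, le_of_lt⟩
  have hadd := Finset.card_filter_add_card_filter_not (s := t) (fun v => c t v ≤ 0)
  rw [hfil, ← hcard, ← hadd, pow_add]
  simp only [eval_pow, eval_X, inv_pow]
  field_simp

end Fan
end Fans

/-! ### Simplicial complexes in a hyperplane and the cones over their simplices -/

section Hyperplane

variable {ι E : Type*} [AddCommGroup E] [Module ℝ E] {φ : E →ₗ[ℝ] ℝ}

lemma cone_id_image [DecidableEq E] (b : ι → E) (s : Finset ι) :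
    cone id (s.image b) = cone b s := by
  refine (cone_subset_cone fun v hv => ?_).antisymm (cone_subset_cone fun i hi => ?_)
  · obtain ⟨i, hi, rfl⟩ := Finset.mem_image.1 hv
    exact mem_cone_of_mem hi
  · exact mem_cone_of_mem (b := id) (Finset.mem_image_of_mem b hi)

lemma mem_convexHull_iff_mem_cone {s : Finset E} (hs : ∀ v ∈ s, φ v = 1) {x : E} :
    x ∈ convexHull ℝ (s : Set E) ↔ x ∈ cone id s ∧ φ x = 1 := by
  have hφ : ∀ c : E → ℝ, φ (∑ v ∈ s, c v • id v) = ∑ v ∈ s, c v := fun c => by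
    rw [map_sum]
    exact Finset.sum_congr rfl fun v hv => by simp [hs v hv]
  rw [Finset.mem_convexHull']
  constructor
  · rintro ⟨c, hc0, hc1, rfl⟩
    exact ⟨⟨c, hc0, rfl⟩, (hφ c).trans hc1⟩
  · rintro ⟨⟨c, hc0, rfl⟩, h1⟩
    exact ⟨c, hc0, (hφ c).symm.trans h1, rfl⟩

lemma eq_zero_or_pos_of_mem_cone {b : ι → E} {s : Finset ι} (hs : ∀ i ∈ s, φ (b i) = 1) {x : E}
    (hx : x ∈ cone b s) : x = 0 ∨ 0 < φ x := by
  obtain ⟨c, hc, rfl⟩ := hx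
  have hφ : φ (∑ i ∈ s, c i • b i) = ∑ i ∈ s, c i := by
    rw [map_sum]
    exact Finset.sum_congr rfl fun v hv => by simp [hs v hv]
  rw [hφ]
  rcases (Finset.sum_nonneg hc).eq_or_lt with h | h
  · left
    refine Finset.sum_eq_zero fun i hi => ?_
    rw [(Finset.sum_eq_zero_iff_of_nonneg hc).1 h.symm i hi, zero_smul]
  · exact Or.inr h

lemma exists_pos_smul_mem {x : E} (hx : 0 < φ x) : ∃ r : ℝ, 0 < r ∧ φ (r • x) = 1 :=
  ⟨(φ x)⁻¹, inv_pos.2 hx, by simp [hx.ne']⟩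

lemma smul_mem_cone_iff {b : ι → E} {s : Finset ι} {r : ℝ} (hr : 0 < r) {x : E} :
    r • x ∈ cone b s ↔ x ∈ cone b s :=
  ⟨fun h => by simpa [smul_smul, hr.ne'] using smul_mem_cone (inv_nonneg.2 hr.le) h,
    smul_mem_cone hr.le⟩

lemma cone_inter_subset [DecidableEq E] {s t : Finset E} (hs : ∀ v ∈ s, φ v = 1)
    (ht : ∀ v ∈ t, φ v = 1)
    (h : convexHull ℝ (s : Set E) ∩ convexHull ℝ (t : Set E) ⊆ convexHull ℝ ((s : Set E) ∩ t)) :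
    cone id s ∩ cone id t ⊆ cone (id : E → E) (s ∩ t) := by
  rintro x ⟨hxs, hxt⟩
  rcases eq_zero_or_pos_of_mem_cone (φ := φ) hs hxs with rfl | hpos
  · exact zero_mem_cone _ _
  · obtain ⟨r, hr, hr1⟩ := exists_pos_smul_mem hpos
    have hmem : r • x ∈ convexHull ℝ ((s ∩ t : Finset E) : Set E) := by
      rw [Finset.coe_inter]
      exact h ⟨(mem_convexHull_iff_mem_cone hs).2 ⟨(smul_mem_cone_iff hr).2 hxs, hr1⟩,
        (mem_convexHull_iff_mem_cone ht).2 ⟨(smul_mem_cone_iff hr).2 hxt, hr1⟩⟩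
    exact (smul_mem_cone_iff hr).1 ((mem_convexHull_iff_mem_cone (φ := φ)
      fun v hv => hs v (Finset.mem_inter.1 hv).1).1 hmem).1

lemma linearIndepOn_of_affineIndependent {s : Finset E} (hs : ∀ v ∈ s, φ v = 1)
    (h : AffineIndependent ℝ (fun v : s => (v : E))) : LinearIndepOn ℝ id (s : Set E) := by
  rw [linearIndepOn_finset_iff]
  intro c hc v hv
  have h1 : ∑ v ∈ s, c v = 0 := by
    have := congrArg φ hc
    rw [map_sum, map_zero] at this
    rw [← this]
    exact Finset.sum_congr rfl fun v hv => by simp [hs v hv]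
  refine (affineIndependent_iff.1 h) Finset.univ (fun v => c v) ?_ ?_ ⟨v, hv⟩ (Finset.mem_univ _)
  · rwa [Finset.univ_eq_attach, Finset.sum_attach s c]
  · rwa [Finset.univ_eq_attach, Finset.sum_attach s fun v => c v • v]

lemma convexHull_subset_iff_mem_cone {s t : Finset E} (hs : ∀ v ∈ s, φ v = 1)
    (ht : ∀ v ∈ t, φ v = 1) :
    convexHull ℝ (s : Set E) ⊆ convexHull ℝ (t : Set E) ↔ ∀ v ∈ s, v ∈ cone id t := by
  constructor
  · intro h v hv
    exact ((mem_convexHull_iff_mem_cone ht).1 (h (subset_convexHull ℝ _ hv))).1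
  · intro h
    exact convexHull_min (fun v hv => (mem_convexHull_iff_mem_cone ht).2 ⟨h v hv, hs v hv⟩)
      (convex_convexHull ℝ _)

end Hyperplane

/-! ### Restricting a fan to a simplicial cone -/

section ConeComplex

variable {ι E : Type*} [AddCommGroup E] [Module ℝ E] [DecidableEq E]

/-- The finite set `𝒮` of sets of vectors generates a simplicial fan. -/
structure IsConeComplex (𝒮 : Finset (Finset E)) : Prop where
  empty_mem : ∅ ∈ 𝒮
  down_closed : ∀ s ∈ 𝒮, ∀ t ⊆ s, t ∈ 𝒮
  indep : ∀ s ∈ 𝒮, LinearIndepOn ℝ id (s : Set E)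
  inter : ∀ s ∈ 𝒮, ∀ t ∈ 𝒮, cone id s ∩ cone id t ⊆ cone (id : E → E) (s ∩ t)

open Classical in
-- The hypothesis `hface` says that a cone meeting the target in a relatively interior point lies
-- inside it. Covering survives restriction because each point is relatively interior to some cone
-- of the family.
lemma IsConeComplex.isFan_filter {𝒮 : Finset (Finset E)} (h : IsConeComplex 𝒮) {b : ι → E}
    {W : Finset ι} (hcov : ∀ x ∈ cone b W, ∃ s ∈ 𝒮, x ∈ cone id s)
    (hface : ∀ s ∈ 𝒮, ∀ x ∈ openCone id s, x ∈ cone b W → ∀ v ∈ s, v ∈ cone b W) :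
    IsFan (𝒮.filter fun s => ∀ v ∈ s, v ∈ cone b W) b W where
  down_closed s hs t hts := by
    obtain ⟨h1, h2⟩ := Finset.mem_filter.1 hs
    exact Finset.mem_filter.2 ⟨h.down_closed s h1 t hts, fun v hv => h2 v (hts hv)⟩
  indep s hs := h.indep s (Finset.mem_filter.1 hs).1
  inter s hs t ht := h.inter s (Finset.mem_filter.1 hs).1 t (Finset.mem_filter.1 ht).1
  cover x hx := by
    obtain ⟨s, hs, hxs⟩ := hcov x hx
    obtain ⟨t, hts, hxt⟩ := exists_openCone_of_mem_cone hxs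
    have ht := h.down_closed s hs t hts
    exact ⟨t, Finset.mem_filter.2 ⟨ht, hface t ht x hxt hx⟩, openCone_subset_cone _ _ hxt⟩
  mem_cone s hs := (Finset.mem_filter.1 hs).2

variable {φ : E →ₗ[ℝ] ℝ}

/-- The faces of a finite simplicial complex, the empty face included. -/
def faceFinset (K : SimplicialComplex ℝ E) (hK : K.faces.Finite) : Finset (Finset E) :=
  insert ∅ hK.toFinset

lemma mem_faceFinset {K : SimplicialComplex ℝ E} {hK : K.faces.Finite} {s : Finset E} :
    s ∈ faceFinset K hK ↔ s = ∅ ∨ s ∈ K.faces := by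
  simp [faceFinset]

lemma isConeComplex_faceFinset {K : SimplicialComplex ℝ E} (hK : K.faces.Finite)
    (hφ : ∀ s ∈ K.faces, ∀ v ∈ s, φ v = 1) : IsConeComplex (faceFinset K hK) where
  empty_mem := mem_faceFinset.2 (Or.inl rfl)
  down_closed s hs t hts := by
    rcases t.eq_empty_or_nonempty with rfl | hne
    · exact mem_faceFinset.2 (Or.inl rfl)
    · rcases mem_faceFinset.1 hs with rfl | hs
      · exact absurd hne (by simp [Finset.subset_empty.1 hts])
      · exact mem_faceFinset.2 (Or.inr (K.down_closed hs hts hne))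
  indep s hs := by
    rcases mem_faceFinset.1 hs with rfl | hs
    · simp
    · exact linearIndepOn_of_affineIndependent (hφ s hs) (K.indep hs)
  inter s hs t ht := by
    have hφ' : ∀ s ∈ faceFinset K hK, ∀ v ∈ s, φ v = 1 := by
      intro s hs
      rcases mem_faceFinset.1 hs with rfl | hs
      · simp
      · exact hφ s hs
    refine cone_inter_subset (hφ' s hs) (hφ' t ht) ?_
    rcases mem_faceFinset.1 hs with rfl | hs
    · simp
    rcases mem_faceFinset.1 ht with rfl | ht
    · simp
    exact K.inter_subset_convexHull hs ht

open Classical in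
/-- The `h`-polynomial of a restricted complex which subdivides a simplex, as a sum over faces. -/
lemma hPoly_restrict_eq {K : SimplicialComplex ℝ E} (hK : K.faces.Finite)
    (hφ : ∀ s ∈ K.faces, ∀ v ∈ s, φ v = 1) {b : ι → E} {W : Finset ι}
    (hb : ∀ i ∈ W, φ (b i) = 1) (hW : LinearIndepOn ℝ b (W : Set ι))
    (hfan : IsFan ((faceFinset K hK).filter fun s => ∀ v ∈ s, v ∈ cone b W) b W) :
    hPoly (restrict K (W.image b)) =
      ∑ s ∈ (faceFinset K hK).filter fun s => ∀ v ∈ s, v ∈ cone b W,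
        X ^ s.card * (1 - X) ^ (W.card - s.card) := by
  set 𝒯 := (faceFinset K hK).filter fun s => ∀ v ∈ s, v ∈ cone b W with h𝒯
  have hbim : ∀ v ∈ W.image b, φ v = 1 := by simpa using hb
  have hmem : ∀ s, s ∈ (restrict K (W.image b)).faces ↔ s ≠ ∅ ∧ s ∈ 𝒯 := by
    intro s
    have h1 : s ∈ (restrict K (W.image b)).faces ↔ s ∈ K.faces ∧
      convexHull ℝ (s : Set E) ⊆ convexHull ℝ ((W.image b : Finset E) : Set E) := Iff.rfl
    rw [h1, h𝒯, Finset.mem_filter, mem_faceFinset]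
    constructor
    · rintro ⟨h2, h3⟩
      refine ⟨(K.nonempty_of_mem_faces h2).ne_empty, Or.inr h2, ?_⟩
      rwa [convexHull_subset_iff_mem_cone (hφ s h2) hbim, cone_id_image] at h3
    · rintro ⟨h2, h3 | h3, h4⟩
      · exact absurd h3 h2
      · refine ⟨h3, ?_⟩
        rwa [convexHull_subset_iff_mem_cone (hφ s h3) hbim, cone_id_image]
  have hle : ∀ s ∈ 𝒯, s.card ≤ W.card := fun s hs =>
    card_le_of_subset_cone hW (hfan.indep s hs) (hfan.mem_cone s hs)
  -- `hPoly` uses the actual dimension of the complex, so a face with `|W|` vertices must be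
  -- exhibited; it comes from a generic vector.
  have hdim : dimSucc (restrict K (W.image b)) = W.card := by
    have hub : ∀ n ∈ Finset.card '' (restrict K (W.image b)).faces, n ≤ W.card := by
      rintro _ ⟨s, hs, rfl⟩
      exact hle s ((hmem s).1 hs).2
    refine le_antisymm (csSup_le' hub) ?_
    obtain ⟨t, ht, hc⟩ := hfan.exists_card_eq hW
    rcases t.eq_empty_or_nonempty with rfl | hne
    · simp [← hc]
    · rw [← hc]
      exact le_csSup ⟨W.card, hub⟩ ⟨t, (hmem t).2 ⟨hne.ne_empty, ht⟩, rfl⟩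
  have hnum : ∀ i, faceNumber (restrict K (W.image b)) i = (𝒯.filter fun s => s.card = i).card := by
    intro i
    rw [faceNumber]
    -- For `i = 0` the convention in `faceNumber` matches the empty set that `faceFinset` adds.
    split_ifs with hi
    · have : (𝒯.filter fun s => s.card = i) = {∅} := by
        ext s
        simp only [hi, Finset.card_eq_zero, Finset.mem_filter, Finset.mem_singleton]
        exact ⟨fun h => h.2, fun h => ⟨h ▸ hfan.empty_mem, h⟩⟩
      rw [this, Finset.card_singleton]
    · rw [← Set.ncard_coe_finset]
      congr 1
      ext s
      simp only [Set.mem_ofPred_eq, hmem, Finset.coe_filter]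
      refine ⟨fun h => ⟨h.1.2, h.2⟩, fun h => ⟨⟨?_, h.1⟩, h.2⟩⟩
      rintro rfl
      exact hi h.2.symm
  rw [hPoly, hdim, ← Finset.sum_fiberwise_of_maps_to (s := 𝒯) (t := Finset.range (W.card + 1))
    (g := Finset.card) fun s hs => Finset.mem_range.2 (Nat.lt_succ_of_le (hle s hs))]
  refine Finset.sum_congr rfl fun i _ => ?_
  rw [hnum, Finset.sum_congr rfl fun s hs => by rw [(Finset.mem_filter.1 hs).2],
    Finset.sum_const, nsmul_eq_mul, mul_assoc]

end ConeComplex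

/-! ### The fan over the barycentric subdivision -/

section Barycentric

variable {V : Type*}

/-- The possibly empty chains of nonempty sets. -/
def IsSdFace (c : Finset (Finset V)) : Prop :=
  ∅ ∉ c ∧ IsChain (· ⊆ ·) (c : Set (Finset V))

lemma IsSdFace.subset {c d : Finset (Finset V)} (hc : IsSdFace c) (h : d ⊆ c) : IsSdFace d :=
  ⟨fun h' => hc.1 (h h'), hc.2.mono (Finset.coe_subset.2 h)⟩

lemma IsSdFace.isFaceChain {c : Finset (Finset V)} (hc : IsSdFace c) (hne : c.Nonempty) :
    IsFaceChain c :=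
  ⟨hne, hc.1, hc.2⟩

/-- The sum of the coordinates. -/
def coordSum (V : Type*) [Fintype V] : (V → ℝ) →ₗ[ℝ] ℝ :=
  ∑ v : V, LinearMap.proj v

lemma coordSum_apply [Fintype V] (x : V → ℝ) : coordSum V x = ∑ v, x v := by
  simp [coordSum]

variable [DecidableEq V]

lemma linearIndepOn_single (S : Finset V) :
    LinearIndepOn ℝ (fun v : V => (Pi.single v 1 : V → ℝ)) (S : Set V) := by
  rw [linearIndepOn_finset_iff]
  intro c hc v hv
  simpa [Finset.sum_apply, Pi.single_apply, hv] using congrFun hc v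

lemma mem_cone_single {S : Finset V} {x : V → ℝ} :
    x ∈ cone (fun v : V => (Pi.single v 1 : V → ℝ)) S ↔ (∀ v, 0 ≤ x v) ∧ ∀ v ∉ S, x v = 0 := by
  constructor
  · rintro ⟨c, hc, rfl⟩
    refine ⟨fun v => ?_, fun v hv => ?_⟩
    · simp only [Finset.sum_apply, Pi.smul_apply, Pi.single_apply, smul_eq_mul, mul_ite, mul_one,
        mul_zero, Finset.sum_ite_eq]
      split_ifs with h
      exacts [hc v h, le_rfl]
    · simp [Finset.sum_apply, Pi.single_apply, hv]
  · rintro ⟨h0, h1⟩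
    refine ⟨x, fun v _ => h0 v, ?_⟩
    ext v
    simp only [Finset.sum_apply, Pi.smul_apply, Pi.single_apply, smul_eq_mul, mul_ite, mul_one,
      mul_zero, Finset.sum_ite_eq]
    split_ifs with h
    exacts [rfl, (h1 v h).symm]

lemma barycenter_nonneg (S : Finset V) (v : V) : 0 ≤ barycenter S v := by
  rw [barycenter_apply]
  split_ifs
  exacts [by positivity, le_rfl]

lemma nonneg_of_mem_cone_barycenter {c : Finset (Finset V)} {x : V → ℝ}
    (hx : x ∈ cone barycenter c) (v : V) : 0 ≤ x v := by
  obtain ⟨a, ha, rfl⟩ := hx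
  rw [Finset.sum_apply]
  exact Finset.sum_nonneg fun S hS => mul_nonneg (ha S hS) (barycenter_nonneg S v)

lemma IsSdFace.linearIndepOn {c : Finset (Finset V)} (hc : IsSdFace c) :
    LinearIndepOn ℝ (barycenter (V := V)) (c : Set (Finset V)) := by
  rcases c.eq_empty_or_nonempty with rfl | hne
  · simp
  · exact linearIndepOn_barycenter (hc.isFaceChain hne)

variable [Fintype V]

lemma coordSum_single (v : V) : coordSum V (Pi.single v 1) = 1 := by
  simp [coordSum_apply]

lemma coordSum_barycenter {S : Finset V} (hS : S ≠ ∅) : coordSum V (barycenter S) = 1 := by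
  have : (S.card : ℝ) ≠ 0 := by simpa using hS
  simp [coordSum_apply, barycenter_apply, this]

lemma IsSdFace.coordSum_barycenter {c : Finset (Finset V)} (hc : IsSdFace c) :
    ∀ S ∈ c, coordSum V (barycenter S) = 1 :=
  fun _ hS => LocalH.coordSum_barycenter fun h => hc.1 (h ▸ hS)

lemma IsSdFace.cone_inter {c d : Finset (Finset V)} (hc : IsSdFace c) (hd : IsSdFace d) :
    cone barycenter c ∩ cone barycenter d ⊆ cone (barycenter (V := V)) (c ∩ d) := by
  have himage : c.image barycenter ∩ d.image barycenter =
      (c ∩ d).image (barycenter (V := V)) := by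
    refine (Finset.image_inter_of_injOn c d (barycenter_injOn.mono ?_)).symm
    rintro S (hS | hS) (rfl : S = ∅)
    exacts [hc.1 hS, hd.1 hS]
  have h1 : ∀ {c : Finset (Finset V)}, IsSdFace c → ∀ v ∈ c.image barycenter, coordSum V v = 1 := by
    intro c hc v hv
    obtain ⟨S, hS, rfl⟩ := Finset.mem_image.1 hv
    exact hc.coordSum_barycenter S hS
  rw [← cone_id_image _ c, ← cone_id_image _ d, ← cone_id_image _ (c ∩ d), ← himage]
  refine cone_inter_subset (h1 hc) (h1 hd) ?_
  rcases c.eq_empty_or_nonempty with rfl | hcne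
  · simp
  rcases d.eq_empty_or_nonempty with rfl | hdne
  · simp
  exact barycenter_inter (hc.isFaceChain hcne) (hd.isFaceChain hdne)

/-- Layer by layer: subtracting the least positive value of `x` on its support `S` removes a
multiple of `barycenter S` and strictly shrinks the support. The successive supports form the chain.
-/
lemma exists_chain_of_nonneg {x : V → ℝ} (hx : ∀ v, 0 ≤ x v) :
    ∃ c : Finset (Finset V), (∀ U ∈ c, U ≠ ∅ ∧ ∀ v ∈ U, 0 < x v) ∧
      IsChain (· ⊆ ·) (c : Set (Finset V)) ∧ x ∈ cone barycenter c := by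
  induction hn : (Finset.univ.filter fun v => 0 < x v).card using Nat.strong_induction_on
    generalizing x with
  | _ n ih =>
    set S := Finset.univ.filter fun v => 0 < x v with hS
    have hout : ∀ v ∉ S, x v = 0 := fun v hv =>
      le_antisymm (not_lt.1 fun h => hv (by simp [hS, h])) (hx v)
    rcases S.eq_empty_or_nonempty with h0 | hne
    · refine ⟨∅, by simp, by simp, ?_⟩
      have : x = 0 := funext fun v => hout v (by simp [h0])
      rw [this]
      exact zero_mem_cone _ _
    · obtain ⟨u, hu, hmin⟩ := Finset.exists_min_image S x hne
      have hupos : 0 < x u := (Finset.mem_filter.1 hu).2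
      set y : V → ℝ := fun v => x v - if v ∈ S then x u else 0 with hy
      have hy0 : ∀ v, 0 ≤ y v := by
        intro v
        simp only [hy]
        split_ifs with hv
        · exact sub_nonneg.2 (hmin v hv)
        · simpa using hx v
      have hyS : (Finset.univ.filter fun v => 0 < y v) ⊂ S := by
        refine Finset.ssubset_iff_subset_ne.2 ⟨fun v hv => ?_, fun h => ?_⟩
        · by_contra hvS
          have h1 := (Finset.mem_filter.1 hv).2
          simp only [hy, hvS, if_false, hout v hvS, sub_zero, lt_irrefl] at h1
        · have h1 := (Finset.mem_filter.1 (h.ge hu)).2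
          simp only [hy, hu, if_true, sub_self, lt_irrefl] at h1
      obtain ⟨c, hc1, hc2, hc3⟩ := ih _ (hn ▸ Finset.card_lt_card hyS) hy0 rfl
      have hcS : ∀ U ∈ c, U ⊆ S := fun U hU v hv =>
        hyS.subset (Finset.mem_filter.2 ⟨Finset.mem_univ v, (hc1 U hU).2 v hv⟩)
      refine ⟨insert S c, ?_, isChain_insert_top hc2 hcS, ?_⟩
      · intro U hU
        rcases Finset.mem_insert.1 hU with rfl | hU
        · exact ⟨hne.ne_empty, fun v hv => (Finset.mem_filter.1 hv).2⟩
        · exact ⟨(hc1 U hU).1, fun v hv => (Finset.mem_filter.1 (hcS U hU hv)).2⟩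
      · have hxy : x = (x u * S.card) • barycenter S + y := by
          have hcard : (S.card : ℝ) ≠ 0 := Nat.cast_ne_zero.2 hne.card_ne_zero
          ext v
          simp only [hy, Pi.add_apply, Pi.smul_apply, barycenter_apply, smul_eq_mul]
          split_ifs with hv
          · rw [mul_assoc, mul_inv_cancel₀ hcard]; ring
          · simp
        rw [hxy]
        exact add_mem_cone (smul_mem_cone (mul_nonneg hupos.le (Nat.cast_nonneg _))
          (mem_cone_of_mem (Finset.mem_insert_self S c)))
          (cone_mono (Finset.subset_insert _ _) hc3)

/-- The finite set `𝒮` generates a fan which refines the fan over the barycentric subdivision. -/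
structure IsSdFan (𝒮 : Finset (Finset (V → ℝ))) : Prop extends IsConeComplex 𝒮 where
  cover : ∀ x : V → ℝ, (∀ v, 0 ≤ x v) → ∃ s ∈ 𝒮, x ∈ cone id s
  exists_sdFace : ∀ s ∈ 𝒮, ∃ c, IsSdFace c ∧ ∀ v ∈ s, v ∈ cone barycenter c

lemma coordSum_eq_one_of_mem_face {K : SimplicialComplex ℝ (V → ℝ)}
    (hK : IsTriangulation K (sdSimplex V)) : ∀ s ∈ K.faces, ∀ v ∈ s, coordSum V v = 1 := by
  intro s hs v hv
  obtain ⟨_, ⟨c, hc, rfl⟩, hsc⟩ := hK.exists_face s hs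
  have h1 : ∀ w ∈ c.image (barycenter (V := V)), coordSum V w = 1 := by
    intro w hw
    obtain ⟨S, hS, rfl⟩ := Finset.mem_image.1 hw
    exact coordSum_barycenter fun h => hc.empty_notMem (h ▸ hS)
  exact ((mem_convexHull_iff_mem_cone h1).1 (hsc (subset_convexHull ℝ _ hv))).2

lemma isSdFan_faceFinset {K : SimplicialComplex ℝ (V → ℝ)}
    (hK : IsTriangulation K (sdSimplex V)) : IsSdFan (faceFinset K hK.finite) where
  toIsConeComplex := isConeComplex_faceFinset hK.finite (coordSum_eq_one_of_mem_face hK)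
  cover x hx := by
    obtain ⟨c, hc1, hc2, hc3⟩ := exists_chain_of_nonneg hx
    have hc : IsSdFace c := ⟨fun h => (hc1 ∅ h).1 rfl, hc2⟩
    rcases eq_zero_or_pos_of_mem_cone hc.coordSum_barycenter hc3 with rfl | hpos
    · exact ⟨∅, mem_faceFinset.2 (Or.inl rfl), zero_mem_cone _ _⟩
    · obtain ⟨r, hr, hr1⟩ := exists_pos_smul_mem hpos
      have hne : c.Nonempty := by
        rw [Finset.nonempty_iff_ne_empty]
        rintro rfl
        obtain ⟨a, -, rfl⟩ := hc3
        simp at hpos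
      have h1 : ∀ w ∈ c.image (barycenter (V := V)), coordSum V w = 1 := by
        intro w hw
        obtain ⟨S, hS, rfl⟩ := Finset.mem_image.1 hw
        exact hc.coordSum_barycenter S hS
      have hsp : r • x ∈ K.space := by
        rw [hK.space_eq]
        refine SimplicialComplex.mem_space_iff.2 ⟨_, ⟨c, hc.isFaceChain hne, rfl⟩, ?_⟩
        rw [mem_convexHull_iff_mem_cone h1, cone_id_image]
        exact ⟨(smul_mem_cone_iff hr).2 hc3, hr1⟩
      obtain ⟨s, hs, hxs⟩ := SimplicialComplex.mem_space_iff.1 hsp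
      refine ⟨s, mem_faceFinset.2 (Or.inr hs), ?_⟩
      rw [mem_convexHull_iff_mem_cone (coordSum_eq_one_of_mem_face hK s hs)] at hxs
      exact (smul_mem_cone_iff hr).1 hxs.1
  exists_sdFace s hs := by
    rcases mem_faceFinset.1 hs with rfl | hs
    · exact ⟨∅, ⟨by simp, by simp⟩, by simp⟩
    · obtain ⟨_, ⟨c, hc, rfl⟩, hsc⟩ := hK.exists_face s hs
      have hc' : IsSdFace c := ⟨hc.empty_notMem, hc.isChain⟩
      refine ⟨c, hc', ?_⟩
      rwa [convexHull_subset_iff_mem_cone (coordSum_eq_one_of_mem_face hK s hs), cone_id_image]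
        at hsc
      intro w hw
      obtain ⟨S, hS, rfl⟩ := Finset.mem_image.1 hw
      exact hc'.coordSum_barycenter S hS

end Barycentric

/-! ### Möbius inversion on the subsets of a finite set -/

section SubsetSum

variable {α R : Type*} [CommRing R]

/-- The sum `∑_{G ⊆ F} c^(|F|-|G|) f(G)`. -/
def subsetSum (c : R) (f : Finset α → R) (F : Finset α) : R :=
  ∑ G ∈ F.powerset, c ^ (F.card - G.card) * f G

lemma subsetSum_congr (c : R) {f g : Finset α → R} {F : Finset α} (h : ∀ G ⊆ F, f G = g G) :
    subsetSum c f F = subsetSum c g F :=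
  Finset.sum_congr rfl fun G hG => by rw [h G (Finset.mem_powerset.1 hG)]

lemma subsetSum_zero (f : Finset α → R) (F : Finset α) : subsetSum 0 f F = f F := by
  rw [subsetSum, Finset.sum_eq_single F]
  · simp
  · intro G hG hne
    have := Finset.card_lt_card ((Finset.mem_powerset.1 hG).ssubset_of_ne hne)
    rw [zero_pow (by omega), zero_mul]
  · simp

/-- This is the binomial theorem on each interval from `H` to `F`. Möbius inversion is the case `c +
d = 0`. -/
lemma subsetSum_subsetSum [DecidableEq α] (c d : R) (f : Finset α → R) (F : Finset α) :
    subsetSum c (subsetSum d f) F = subsetSum (c + d) f F := by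
  simp only [subsetSum, Finset.mul_sum]
  rw [Finset.sum_comm' (t' := F.powerset) (s' := fun H => Finset.Icc H F)]
  · refine Finset.sum_congr rfl fun H hH => ?_
    rw [add_comm c d, ← sum_Icc_pow_mul_pow d c (Finset.mem_powerset.1 hH), Finset.sum_mul]
    exact Finset.sum_congr rfl fun G _ => by ring
  · intro G H
    simp only [Finset.mem_powerset, Finset.mem_Icc]
    exact ⟨fun h => ⟨⟨h.2, h.1⟩, h.2.trans h.1⟩, fun h => ⟨h.1.2, h.1.1⟩⟩

end SubsetSum

/-! ### Face sums of a fan refining the fan over the barycentric subdivision -/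

section SdFan

variable {V : Type*} [DecidableEq V] {𝒮 : Finset (Finset (V → ℝ))}

open Classical in
/-- The `h`-polynomial of the restriction of `𝒮` to the cone generated by the `b i`, `i ∈ W`. -/
def faceSum {ι : Type*} (𝒮 : Finset (Finset (V → ℝ))) (b : ι → V → ℝ) (W : Finset ι) : ℝ[X] :=
  ∑ s ∈ 𝒮.filter fun s => ∀ v ∈ s, v ∈ cone b W, X ^ s.card * (1 - X) ^ (W.card - s.card)

open Classical in
/-- The contribution to the `h`-polynomial of the cones of `𝒮` whose relative interior is
contained in the relative interior of the cone over the face `c` of the barycentric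
subdivision. -/
def interiorSum (𝒮 : Finset (Finset (V → ℝ))) (c : Finset (Finset V)) : ℝ[X] :=
  ∑ s ∈ 𝒮.filter fun s => ∑ v ∈ s, v ∈ openCone barycenter c,
    X ^ s.card * (1 - X) ^ (c.card - s.card)

lemma isSdFace_of_mem_faceChains {S : Finset V} {G c : Finset (Finset V)}
    (hc : c ∈ faceChains S G) : IsSdFace c :=
  ⟨fun h0 => ((mem_faceChains.1 hc).1 ∅ h0).1 rfl, (mem_faceChains.1 hc).2.1⟩

variable [Fintype V]

lemma IsSdFace.subset_of_openCone {c d : Finset (Finset V)} (hc : IsSdFace c) (hd : IsSdFace d)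
    {x : V → ℝ} (hxc : x ∈ openCone barycenter c) (hxd : x ∈ cone barycenter d) : c ⊆ d := by
  obtain ⟨a, ha, hax⟩ := hc.cone_inter hd ⟨openCone_subset_cone _ _ hxc, hxd⟩
  obtain ⟨e, he, rfl⟩ := hxc
  have h1 : ∑ S ∈ c, e S • barycenter S =
      ∑ S ∈ c, (if S ∈ c ∩ d then a S else 0) • barycenter (V := V) S := by
    simp only [ite_smul, zero_smul, Finset.sum_ite_mem]
    rw [← Finset.inter_assoc, Finset.inter_self, hax]
  intro S hS
  have h2 := coeff_eq_of_sum_eq hc.linearIndepOn h1 S hS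
  by_contra hSd
  rw [if_neg (by simp [hSd])] at h2
  exact (he S hS).ne' h2

lemma IsSdFace.eq_of_openCone {c d : Finset (Finset V)} (hc : IsSdFace c) (hd : IsSdFace d)
    {x : V → ℝ} (hxc : x ∈ openCone barycenter c) (hxd : x ∈ openCone barycenter d) : c = d :=
  (hc.subset_of_openCone hd hxc (openCone_subset_cone _ _ hxd)).antisymm
    (hd.subset_of_openCone hc hxd (openCone_subset_cone _ _ hxc))

lemma IsSdFan.nonneg (h : IsSdFan 𝒮) {s : Finset (V → ℝ)} (hs : s ∈ 𝒮) {x : V → ℝ}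
    (hx : x ∈ s) (v : V) : 0 ≤ x v := by
  obtain ⟨c, -, hsc⟩ := h.exists_sdFace s hs
  exact nonneg_of_mem_cone_barycenter (hsc x hx) v

/-- The cone of `s` lies in the cone over some face `d`, and the cones over `c` and `d` meet in
their common face `c ∩ d`. A cone with a relatively interior point on a face lies in that face. -/
lemma IsSdFan.mem_cone_barycenter (h : IsSdFan 𝒮) {c : Finset (Finset V)} (hc : IsSdFace c)
    {s : Finset (V → ℝ)} (hs : s ∈ 𝒮) {x : V → ℝ} (hx : x ∈ openCone id s)
    (hxc : x ∈ cone barycenter c) : ∀ v ∈ s, v ∈ cone barycenter c := by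
  obtain ⟨d, hd, hsd⟩ := h.exists_sdFace s hs
  have hxd : x ∈ cone barycenter d := cone_subset_cone hsd (openCone_subset_cone _ _ hx)
  have := mem_cone_of_openCone_mem hd.linearIndepOn (Finset.inter_subset_right (s₁ := c))
    (d := id) hsd hx (hc.cone_inter hd ⟨hxc, hxd⟩)
  exact fun v hv => cone_mono Finset.inter_subset_left (this v hv)

lemma IsSdFan.mem_cone_single (h : IsSdFan 𝒮) {S : Finset V}
    {s : Finset (V → ℝ)} (hs : s ∈ 𝒮) {x : V → ℝ} (hx : x ∈ openCone id s)
    (hxS : x ∈ cone (fun v : V => (Pi.single v 1 : V → ℝ)) S) :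
    ∀ v ∈ s, v ∈ cone (fun v : V => (Pi.single v 1 : V → ℝ)) S :=
  mem_cone_of_openCone_mem (linearIndepOn_single Finset.univ) (Finset.subset_univ S)
    (fun v hv => LocalH.mem_cone_single.2 ⟨h.nonneg hs hv, by simp⟩) hx hxS

open Classical in
lemma IsSdFan.isFan_barycenter (h : IsSdFan 𝒮) {c : Finset (Finset V)} (hc : IsSdFace c) :
    IsFan (𝒮.filter fun s => ∀ v ∈ s, v ∈ cone barycenter c) barycenter c :=
  h.isFan_filter (fun x hx => h.cover x (nonneg_of_mem_cone_barycenter hx))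
    fun _ hs _ hx hxc => h.mem_cone_barycenter hc hs hx hxc

open Classical in
lemma IsSdFan.isFan_single (h : IsSdFan 𝒮) (S : Finset V) :
    IsFan (𝒮.filter fun s => ∀ v ∈ s, v ∈ cone (fun v : V => (Pi.single v 1 : V → ℝ)) S)
      (fun v : V => (Pi.single v 1 : V → ℝ)) S :=
  h.isFan_filter (fun x hx => h.cover x (LocalH.mem_cone_single.1 hx).1)
    fun _ hs _ hx hxS => h.mem_cone_single hs hx hxS

lemma IsSdFan.exists_carrier (h : IsSdFan 𝒮) {s : Finset (V → ℝ)} (hs : s ∈ 𝒮) :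
    ∃ c, IsSdFace c ∧ ∑ v ∈ s, v ∈ openCone barycenter c := by
  obtain ⟨d, hd, hsd⟩ := h.exists_sdFace s hs
  obtain ⟨c, hcd, hc⟩ := exists_openCone_of_mem_cone (sum_mem_cone hsd)
  exact ⟨c, hd.subset hcd, hc⟩

lemma IsSdFan.card_le (h : IsSdFan 𝒮) {s : Finset (V → ℝ)} (hs : s ∈ 𝒮) {c : Finset (Finset V)}
    (hc : IsSdFace c) (hsc : ∑ v ∈ s, v ∈ openCone barycenter c) : s.card ≤ c.card :=
  card_le_of_subset_cone hc.linearIndepOn (h.indep s hs)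
    (h.mem_cone_barycenter hc hs (sum_mem_openCone s) (openCone_subset_cone _ _ hsc))

/-- Each `s` is counted at the unique `c` whose open cone contains the sum of its generators. The
exponent splits as `n - |s| = (n - |c|) + (|c| - |s|)`. -/
lemma IsSdFan.sum_eq_sum_interiorSum (h : IsSdFan 𝒮) {𝒢 : Finset (Finset (Finset V))}
    (hG : ∀ c ∈ 𝒢, IsSdFace c) {n : ℕ} (hn : ∀ c ∈ 𝒢, c.card ≤ n)
    {𝒜 : Finset (Finset (V → ℝ))}
    (hA : ∀ s, s ∈ 𝒜 ↔ s ∈ 𝒮 ∧ ∃ c ∈ 𝒢, ∑ v ∈ s, v ∈ openCone barycenter c) :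
    ∑ s ∈ 𝒜, (X : ℝ[X]) ^ s.card * (1 - X) ^ (n - s.card) =
      ∑ c ∈ 𝒢, (1 - X) ^ (n - c.card) * interiorSum 𝒮 c := by
  classical
  have hU : 𝒜 = 𝒢.biUnion fun c => 𝒮.filter fun s => ∑ v ∈ s, v ∈ openCone barycenter c := by
    ext s
    simp only [hA, Finset.mem_biUnion, Finset.mem_filter]
    exact ⟨fun ⟨h1, c, h2, h3⟩ => ⟨c, h2, h1, h3⟩, fun ⟨c, h2, h1, h3⟩ => ⟨h1, c, h2, h3⟩⟩
  rw [hU, Finset.sum_biUnion]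
  · refine Finset.sum_congr rfl fun c hc => ?_
    rw [interiorSum, Finset.mul_sum]
    refine Finset.sum_congr (by congr) fun s hs => ?_
    obtain ⟨hs, hsc⟩ := Finset.mem_filter.1 hs
    have h1 := h.card_le hs (hG c hc) hsc
    have h2 := hn c hc
    rw [mul_left_comm, ← pow_add]
    congr 2
    omega
  · intro c hc d hd hcd
    rw [Function.onFun, Finset.disjoint_left]
    intro s hs hs'
    exact hcd ((hG c hc).eq_of_openCone (hG d hd) (Finset.mem_filter.1 hs).2
      (Finset.mem_filter.1 hs').2)

lemma IsSdFan.faceSum_barycenter (h : IsSdFan 𝒮) {c : Finset (Finset V)} (hc : IsSdFace c) :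
    faceSum 𝒮 barycenter c = subsetSum (1 - X) (interiorSum 𝒮) c := by
  classical
  refine h.sum_eq_sum_interiorSum (fun d hd => hc.subset (Finset.mem_powerset.1 hd))
    (fun d hd => Finset.card_le_card (Finset.mem_powerset.1 hd)) fun s => ?_
  rw [Finset.mem_filter]
  refine and_congr_right fun hs => ⟨fun h1 => ?_, ?_⟩
  · obtain ⟨d, hdc, hd⟩ := exists_openCone_of_mem_cone (sum_mem_cone h1)
    exact ⟨d, Finset.mem_powerset.2 hdc, hd⟩
  · rintro ⟨d, hdc, hd⟩
    exact h.mem_cone_barycenter hc hs (sum_mem_openCone s)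
      (cone_mono (Finset.mem_powerset.1 hdc) (openCone_subset_cone _ _ hd))

/-- The barycenters of the members of `c` are linearly independent and lie in the `|S|`-dimensional
cone over the simplex `S`. -/
lemma card_le_of_mem_faceChains {S : Finset V} {G c : Finset (Finset V)}
    (hc : c ∈ faceChains S G) : c.card ≤ S.card := by
  classical
  have hli := (isSdFace_of_mem_faceChains hc).linearIndepOn
  rw [← Finset.card_image_of_injOn hli.injOn]
  refine card_le_of_subset_cone (linearIndepOn_single S) ?_ fun x hx => ?_
  · rw [Finset.coe_image]
    exact hli.id_image
  · obtain ⟨U, hU, rfl⟩ := Finset.mem_image.1 hx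
    refine LocalH.mem_cone_single.2 ⟨barycenter_nonneg U, fun v hv => ?_⟩
    rw [barycenter_apply, if_neg fun hvU => hv (((mem_faceChains.1 hc).1 U hU).2 hvU)]

lemma IsSdFan.faceSum_single (h : IsSdFan 𝒮) (S : Finset V) :
    faceSum 𝒮 (fun v : V => (Pi.single v 1 : V → ℝ)) S =
      ∑ c ∈ faceChains S ∅, (1 - X) ^ (S.card - c.card) * interiorSum 𝒮 c := by
  classical
  refine h.sum_eq_sum_interiorSum (fun c hc => isSdFace_of_mem_faceChains hc)
    (fun c hc => card_le_of_mem_faceChains hc) fun s => ?_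
  rw [Finset.mem_filter]
  refine and_congr_right fun hs => ⟨fun h1 => ?_, ?_⟩
  · obtain ⟨c, hc, a, ha, hac⟩ := h.exists_carrier hs
    refine ⟨c, mem_faceChains.2 ⟨fun U hU => ⟨fun h0 => hc.1 (h0 ▸ hU), fun v hv => ?_⟩, hc.2,
      Finset.empty_subset _⟩, a, ha, hac⟩
    by_contra hvS
    have h2 := (LocalH.mem_cone_single.1 (sum_mem_cone h1)).2 v hvS
    rw [← hac] at h2
    simp only [Finset.sum_apply, Pi.smul_apply, smul_eq_mul] at h2
    rw [Finset.sum_eq_zero_iff_of_nonneg fun T hT =>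
      mul_nonneg (ha T hT).le (barycenter_nonneg T v)] at h2
    have h3 := h2 U hU
    rw [barycenter_apply, if_pos hv] at h3
    have hU0 : (0 : ℝ) < U.card := Nat.cast_pos.2 (Finset.card_pos.2 ⟨v, hv⟩)
    exact (mul_pos (ha U hU) (inv_pos.2 hU0)).ne' h3
  · rintro ⟨c, hc, hsc⟩
    refine h.mem_cone_single hs (sum_mem_openCone s) ?_
    refine cone_subset_cone (fun U hU => ?_) (openCone_subset_cone _ _ hsc)
    refine LocalH.mem_cone_single.2 ⟨barycenter_nonneg U, fun v hv => ?_⟩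
    rw [barycenter_apply, if_neg fun hvU => hv (((mem_faceChains.1 hc).1 U hU).2 hvU)]

lemma IsSdFan.reversal (h : IsSdFan 𝒮) {c : Finset (Finset V)} (hc : IsSdFace c) {x : ℝ}
    (hx : x ≠ 0) : x ^ c.card * (faceSum 𝒮 barycenter c).eval x⁻¹ = (interiorSum 𝒮 c).eval x := by
  classical
  have h1 := (h.isFan_barycenter hc).reversal hc.linearIndepOn hx
  rw [Finset.filter_filter] at h1
  rw [faceSum, interiorSum]
  convert h1 with s hs
  exact ⟨fun h2 => ⟨h.mem_cone_barycenter hc hs (sum_mem_openCone s)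
    (openCone_subset_cone _ _ h2), h2⟩, fun h2 => h2.2⟩

/-- The local `h`-polynomial of the restriction of the fan `𝒮` to the cone over the face `c`
of the barycentric subdivision. -/
def localSum (𝒮 : Finset (Finset (V → ℝ))) (c : Finset (Finset V)) : ℝ[X] :=
  subsetSum (-1) (faceSum 𝒮 barycenter) c

lemma IsSdFan.localSum_empty (h : IsSdFan 𝒮) : localSum 𝒮 ∅ = 1 := by
  classical
  have h1 : (𝒮.filter fun s => ∀ v ∈ s, v ∈ cone (barycenter (V := V)) ∅) = {∅} := by
    ext s
    rw [Finset.mem_filter, Finset.mem_singleton]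
    constructor
    · rintro ⟨hs, hsc⟩
      exact Finset.card_eq_zero.1 (Nat.le_zero.1
        (card_le_of_subset_cone (by simp) (h.indep s hs) hsc))
    · rintro rfl
      exact ⟨h.empty_mem, by simp⟩
  have h2 : faceSum 𝒮 (barycenter (V := V)) ∅ = 1 := by
    rw [faceSum]
    convert Finset.sum_singleton _ (∅ : Finset (V → ℝ))
    simp
  simp [localSum, subsetSum, h2]

/-- The transforms with parameters `-1` and `1 - X` compose to the one with parameter `-X`, whose
inverse, with parameter `X`, recovers `interiorSum` from `localSum`. -/
lemma IsSdFan.localSum_eq (h : IsSdFan 𝒮) {c : Finset (Finset V)} (hc : IsSdFace c) :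
    localSum 𝒮 c = subsetSum (-X) (interiorSum 𝒮) c := by
  rw [localSum, subsetSum_congr (-1) fun d hd => h.faceSum_barycenter (hc.subset hd),
    subsetSum_subsetSum]
  congr 1
  ring

lemma IsSdFan.interiorSum_eq (h : IsSdFan 𝒮) {c : Finset (Finset V)} (hc : IsSdFace c) :
    interiorSum 𝒮 c = subsetSum X (localSum 𝒮) c := by
  rw [subsetSum_congr X fun d hd => h.localSum_eq (hc.subset hd), subsetSum_subsetSum,
    add_neg_cancel, subsetSum_zero]

/-- Local `h`-polynomials are symmetric. -/
lemma IsSdFan.localSum_symm (h : IsSdFan 𝒮) {c : Finset (Finset V)} (hc : IsSdFace c) {x : ℝ}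
    (hx : x ≠ 0) : x ^ c.card * (localSum 𝒮 c).eval x⁻¹ = (localSum 𝒮 c).eval x := by
  -- Only the left side is expanded through `interiorSum`; the right side keeps `faceSum`.
  -- `IsSdFan.reversal` then matches the two sums term by term.
  conv_lhs => rw [h.localSum_eq hc]
  rw [localSum, subsetSum, subsetSum, eval_finsetSum, eval_finsetSum, Finset.mul_sum]
  refine Finset.sum_congr rfl fun d hd => ?_
  have hdc := Finset.mem_powerset.1 hd
  obtain ⟨k, hk⟩ : ∃ k, c.card = d.card + k := Nat.exists_eq_add_of_le (Finset.card_le_card hdc)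
  have h1 := h.reversal (hc.subset hdc) (inv_ne_zero hx)
  rw [inv_inv] at h1
  simp only [eval_mul, eval_pow, eval_neg, eval_X, eval_one]
  rw [← h1, hk, Nat.add_sub_cancel_left, pow_add, neg_pow x⁻¹, inv_pow, inv_pow]
  field_simp

/-- For fixed `S`, expanding each `interiorSum` through `localSum` and collecting the chains `d ⊇ c`
leaves `linkSum S c` as the coefficient of `localSum 𝒮 c`. Exchanging the sums over `S` and `c` then
gives the decomposition. -/
lemma IsSdFan.sum_faceSum_single (h : IsSdFan 𝒮) :
    ∑ S : Finset V, (-1) ^ (Fintype.card V - S.card) *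
        faceSum 𝒮 (fun v : V => (Pi.single v 1 : V → ℝ)) S =
      ∑ c ∈ faceChains Finset.univ ∅, localSum 𝒮 c *
        ∑ S ∈ Finset.univ.filter (fun S : Finset V => ∀ U ∈ c, U ⊆ S),
          (-1) ^ (Fintype.card V - S.card) * linkSum S c := by
  have h1 : ∀ S : Finset V, faceSum 𝒮 (fun v : V => (Pi.single v 1 : V → ℝ)) S =
      ∑ c ∈ faceChains S ∅, localSum 𝒮 c * linkSum S c := by
    intro S
    have h2 : ∀ d ∈ faceChains S ∅, (1 - X) ^ (S.card - d.card) * interiorSum 𝒮 d =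
        ∑ c ∈ d.powerset, localSum 𝒮 c * (X ^ (d.card - c.card) * (1 - X) ^ (S.card - d.card)) := by
      intro d hd
      rw [h.interiorSum_eq (isSdFace_of_mem_faceChains hd), subsetSum, Finset.mul_sum]
      exact Finset.sum_congr rfl fun c _ => by ring
    rw [h.faceSum_single, Finset.sum_congr rfl h2, Finset.sum_comm' (t' := faceChains S ∅)
      (s' := fun c => faceChains S c)]
    · exact Finset.sum_congr rfl fun c _ => by rw [linkSum, Finset.mul_sum]
    · intro d c
      simp only [mem_faceChains, Finset.mem_powerset, Finset.empty_subset, and_true]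
      constructor
      · rintro ⟨⟨h3, h4⟩, h5⟩
        exact ⟨⟨h3, h4, h5⟩, fun U hU => h3 U (h5 hU), h4.mono (Finset.coe_subset.2 h5)⟩
      · rintro ⟨⟨h3, h4, h5⟩, -⟩
        exact ⟨⟨h3, h4⟩, h5⟩
  simp only [h1, Finset.mul_sum]
  rw [Finset.sum_comm' (t' := faceChains Finset.univ ∅)
    (s' := fun c => Finset.univ.filter (fun S : Finset V => ∀ U ∈ c, U ⊆ S))]
  · exact Finset.sum_congr rfl fun c _ => Finset.sum_congr rfl fun S _ => by ring
  · intro S c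
    simp only [mem_faceChains, Finset.empty_subset, and_true, Finset.mem_univ, true_and,
      Finset.mem_filter, Finset.subset_univ]
    exact ⟨fun h3 => ⟨fun U hU => (h3.1 U hU).2, fun U hU => (h3.1 U hU).1, h3.2⟩,
      fun h3 => ⟨fun U hU => ⟨h3.2.1 U hU, h3.1 U hU⟩, h3.2.2⟩⟩

/-- The indices `|c|` and `|V| - |c|` of the two factors add up to `|V|` for every `c`, so all the
summands lie in one cone, which is closed under addition. -/
lemma IsSdFan.sum_faceSum_single_mem_gammaCone (h : IsSdFan 𝒮)
    (hpos : ∀ c, IsSdFace c → GammaPositive (localSum 𝒮 c)) :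
    ∑ S : Finset V, (-1) ^ (Fintype.card V - S.card) *
        faceSum 𝒮 (fun v : V => (Pi.single v 1 : V → ℝ)) S ∈ gammaCone (Fintype.card V) := by
  rw [h.sum_faceSum_single]
  refine sum_mem fun c hc => ?_
  have hc' := isSdFace_of_mem_faceChains hc
  have hle : c.card ≤ Fintype.card V := card_le_of_mem_faceChains hc
  have h5 := mul_mem_gammaCone ((hpos c hc').mem_gammaCone fun x hx => h.localSum_symm hc' hx)
    (sum_linkSum_mem_gammaCone hc'.2 hc'.1)
  rwa [Nat.add_sub_cancel' hle] at h5

end SdFan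

/-! ### The theorem -/

section Main

variable {V : Type*} [Fintype V] [DecidableEq V]

lemma localH_image_eq {ι E : Type*} [AddCommGroup E] [Module ℝ E] [DecidableEq E]
    (K : SimplicialComplex ℝ E) {b : ι → E} {W : Finset ι} (hb : Set.InjOn b (W : Set ι)) :
    localH K (W.image b) = subsetSum (-1) (fun F => hPoly (restrict K (F.image b))) W := by
  rw [localH, subsetSum, Finset.powerset_image, Finset.sum_image]
  · refine Finset.sum_congr rfl fun F hF => ?_
    rw [Finset.card_image_of_injOn hb, Finset.card_image_of_injOn
      (hb.mono (Finset.coe_subset.2 (Finset.mem_powerset.1 hF)))]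
  · intro F hF G hG h
    have h' := congrArg (fun s : Finset E => (s : Set E)) h
    simp only [Finset.coe_image] at h'
    exact Finset.coe_injective ((hb.image_eq_image_iff
      (Finset.coe_subset.2 (Finset.mem_powerset.1 hF))
      (Finset.coe_subset.2 (Finset.mem_powerset.1 hG))).1 h')

lemma restrict_restrict {E : Type*} [AddCommGroup E] [Module ℝ E] (K : SimplicialComplex ℝ E)
    {F W : Finset E} (h : F ⊆ W) : restrict (restrict K W) F = restrict K F := by
  ext s
  exact ⟨fun hs => ⟨hs.1.1, hs.2⟩, fun hs => ⟨⟨hs.1, hs.2.trans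
    (convexHull_mono (Finset.coe_subset.2 h))⟩, hs.2⟩⟩

lemma localH_restrict {E : Type*} [AddCommGroup E] [Module ℝ E] (K : SimplicialComplex ℝ E)
    (W : Finset E) : localH (restrict K W) W = localH K W :=
  Finset.sum_congr rfl fun F hF => by rw [restrict_restrict K (Finset.mem_powerset.1 hF)]

lemma localH_barycenter {K : SimplicialComplex ℝ (V → ℝ)} (hK : IsTriangulation K (sdSimplex V))
    {c : Finset (Finset V)} (hc : IsSdFace c) :
    localH K (c.image barycenter) = localSum (faceFinset K hK.finite) c := by
  rw [localH_image_eq K hc.linearIndepOn.injOn]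
  refine subsetSum_congr _ fun d hd => ?_
  have hd' := hc.subset hd
  exact hPoly_restrict_eq hK.finite (coordSum_eq_one_of_mem_face hK) hd'.coordSum_barycenter
    hd'.linearIndepOn ((isSdFan_faceFinset hK).isFan_barycenter hd')

lemma localH_simplexVertices {K : SimplicialComplex ℝ (V → ℝ)}
    (hK : IsTriangulation K (sdSimplex V)) :
    localH K (simplexVertices V) = ∑ S : Finset V, (-1) ^ (Fintype.card V - S.card) *
      faceSum (faceFinset K hK.finite) (fun v : V => (Pi.single v 1 : V → ℝ)) S := by
  rw [simplexVertices, localH_image_eq K (linearIndepOn_single Finset.univ).injOn, subsetSum,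
    Finset.powerset_univ, Finset.card_univ]
  refine Finset.sum_congr rfl fun S _ => ?_
  rw [hPoly_restrict_eq hK.finite (coordSum_eq_one_of_mem_face hK)
    (fun v _ => coordSum_single v) (linearIndepOn_single S)
    ((isSdFan_faceFinset hK).isFan_single S)]
  rfl

end Main

end LocalH

end

theorem mainTheorem5 {V : Type*} [Fintype V] [DecidableEq V]
    (Γ' : Geometry.SimplicialComplex ℝ (V → ℝ))
    (hΓ' : LocalH.IsTriangulation Γ' (LocalH.sdSimplex V))
    (hE : ∀ W ∈ (LocalH.sdSimplex V).faces,
      LocalH.GammaPositive (LocalH.localH (LocalH.restrict Γ' W) W)) :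
    LocalH.GammaPositive (LocalH.localH Γ' (LocalH.simplexVertices V)) := by
  rw [LocalH.localH_simplexVertices hΓ']
  refine LocalH.gammaPositive_of_mem_gammaCone
    ((LocalH.isSdFan_faceFinset hΓ').sum_faceSum_single_mem_gammaCone fun c hc => ?_)
  rcases c.eq_empty_or_nonempty with rfl | hne
  -- The empty face is not listed among the faces of `sdSimplex V`, so `hE` does not cover it; its
  -- local `h`-polynomial is `1`.
  · rw [(LocalH.isSdFan_faceFinset hΓ').localSum_empty]
    exact LocalH.gammaPositive_of_mem_gammaCone LocalH.one_mem_gammaCone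
  · rw [← LocalH.localH_barycenter hΓ' hc, ← LocalH.localH_restrict]
    exact hE _ ⟨c, hc.isFaceChain hne, rfl⟩
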